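/- Let $M$ be a $k\times l$ matrix with entries in $\{0,1,-1\}$. Draw in the rectangle $[0,l]\times[0,k]$, divided into unit cells with rows listed from top to bottom, a segment of slope $1$ (a diagonal of the cell) in each cell whose entry is $1$ and a segment of slope $-1$ in each cell whose entry is $-1$; this is the grid of $M$. For $n\ge 0$ let $\mathcal G_n=\mathcal G_n(M)\subseteq\mathcal S_n$ be the set of permutations obtained by placing $n$ dots on the segments, no two with the same $x$- or $y$-coordinate, labelling them $1,\dots,n$ by increasing $y$-coordinate and reading the labels by increasing $x$-coordinate. Let $\mathcal G^{\mathrm{ver}}_n$, $\mathcal G^{\mathrm{hor}}_n$ and $\mathcal G^{\mathrm{rot}}_n$ be the sets obtained in the same way from the grid of $M$ after exchanging top and bottom, after exchanging left and right, and after rotating by $180^\circ$, respectively. For $\pi\in\mathcal S_n$ put $\operatorname{Des}(\pi)=\{i\in[n-1]:\pi(i)>\pi(i+1)\}$, for $D\subseteq[n-1]$ put $$F_{n,D}=\sum_{\substack{i_1\le i_2\le\cdots\le i_n\\ i_j<i_{j+1}\text{ if }j\in D}}x_{i_1}x_{i_2}\cdots x_{i_n},$$ and for $\mathcal B\subseteq\mathcal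 S_n$ put $\mathcal Q(\mathcal B)=\sum_{\pi\in\mathcal B}F_{n,\operatorname{Des}(\pi)}$. For a partition $\lambda\vdash n$ let $S^\lambda$ be the Specht module over $\mathbb C$, $\chi^\lambda$ its character and $s_\lambda$ the Schur function; for a character $\chi=\sum_{\lambda\vdash n}c_\lambda\chi^\lambda$ of $\mathcal S_n$ put $\operatorname{ch}(\chi)=\sum_{\lambda\vdash n}c_\lambda s_\lambda$. The set $\mathcal B$ is called fine for a finite-dimensional complex $\mathcal S_n$-representation $\rho$ if $\operatorname{ch}(\chi^\rho)=\mathcal Q(\mathcal B)$, and Schur-positive if $\mathcal Q(\mathcal B)$ is a linear combination of the $s_\lambda$, $\lambda\vdash n$, with nonnegative coefficients. Then, for every $M$ and every $n\ge 0$: 1. if $\mathcal G_n$ is fine for the representation $\rho$, then $\mathcal G^{\mathrm{ver}}_n$ and $\mathcal G^{\mathrm{hor}}_n$ are both fine for $S^{(1^n)}\otimes\rho$; 2. if $\mathcal G_n$ is Schur-positive, then $\mathcal Q(\mathcal G_n)=\mathcal Q(\mathcal G^{\mathrm{rot}}_n)$. -/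

import Mathlib

open scoped TensorProduct

noncomputable section

namespace GridReflections

/-! ### Descents and the quasisymmetric generating function -/

/-- The descent set of a permutation of `Fin n`, in zero-based positions: `d` is a descent if
`π(d) > π(d+1)`. (The number `d` here is the descent `d + 1 ∈ [n-1]` of one-based notation.) -/
def descentSet {n : ℕ} (π : Equiv.Perm (Fin n)) : Set ℕ :=
  {d | ∃ h : d + 1 < n, π ⟨d + 1, h⟩ < π ⟨d, Nat.lt_of_succ_lt h⟩}

/-- The exponent vector of the monomial `x_{i 0} x_{i 1} ⋯ x_{i (n-1)}`. -/
def wordExponent {n : ℕ} (i : Fin n → ℕ) : ℕ →₀ ℕ :=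
  ∑ j, Finsupp.single (i j) 1

/-- The fundamental quasisymmetric function `F_{n,D}` in the variables `x_0, x_1, x_2, …`: the sum
of `x_{i 0} ⋯ x_{i (n-1)}` over all weakly increasing words `i` that increase strictly at each
position of `D`. -/
def fundamentalQSym (n : ℕ) (D : Set ℕ) : MvPowerSeries ℕ ℂ :=
  fun m => (Set.ncard {i : Fin n → ℕ | Monotone i ∧
    (∀ (d : ℕ) (h : d + 1 < n), d ∈ D → i ⟨d, Nat.lt_of_succ_lt h⟩ < i ⟨d + 1, h⟩) ∧
    wordExponent i = m} : ℂ)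

/-- `Q(B) = ∑_{π ∈ B} F_{n, Des π}` for a set `B` of permutations. -/
def quasiSym {n : ℕ} (B : Set (Equiv.Perm (Fin n))) : MvPowerSeries ℕ ℂ :=
  ∑ π ∈ B.toFinite.toFinset, fundamentalQSym n (descentSet π)

/-! ### Partitions and Schur functions -/

/-- Partitions of `n`, as Young diagrams with `n` cells (English notation: the cell `(r, c)` is in
row `r` and column `c`). -/
abbrev Shape (n : ℕ) : Type := {μ : YoungDiagram // μ.card = n}

theorem cells_subset_of_card {n : ℕ} (μ : Shape n) :
    μ.1.cells ⊆ Finset.range n ×ˢ Finset.range n := by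
  rintro ⟨r, c⟩ h
  have hrow : (Finset.range (c + 1)).image (fun j => (r, j)) ⊆ μ.1.cells := by
    intro x hx
    obtain ⟨j, hj, rfl⟩ := Finset.mem_image.1 hx
    exact μ.1.up_left_mem le_rfl (Nat.lt_succ_iff.1 (Finset.mem_range.1 hj)) h
  have hcol : (Finset.range (r + 1)).image (fun i => (i, c)) ⊆ μ.1.cells := by
    intro x hx
    obtain ⟨j, hj, rfl⟩ := Finset.mem_image.1 hx
    exact μ.1.up_left_mem (Nat.lt_succ_iff.1 (Finset.mem_range.1 hj)) le_rfl h
  have h1 := Finset.card_le_card hrow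
  have h2 := Finset.card_le_card hcol
  rw [Finset.card_image_of_injective _ (fun a b hab => by simpa using hab), Finset.card_range] at h1
  rw [Finset.card_image_of_injective _ (fun a b hab => by simpa using hab), Finset.card_range] at h2
  have h3 : μ.1.cells.card = n := μ.2
  simp only [Finset.mem_product, Finset.mem_range]
  omega

instance finiteShape (n : ℕ) : Finite (Shape n) := by
  refine Finite.of_injective
    (fun μ : Shape n => (⟨μ.1.cells, Finset.mem_powerset.2 (cells_subset_of_card μ)⟩ :
      {s // s ∈ (Finset.range n ×ˢ Finset.range n).powerset})) ?_
  intro μ ν h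
  exact Subtype.ext (YoungDiagram.ext (congrArg Subtype.val h))

instance fintypeShape (n : ℕ) : Fintype (Shape n) := Fintype.ofFinite _

/-- The exponent vector of the monomial `x^T` of a semistandard tableau. -/
def tableauExponent {μ : YoungDiagram} (T : SemistandardYoungTableau μ) : ℕ →₀ ℕ :=
  ∑ c ∈ μ.cells, Finsupp.single (T c.1 c.2) 1

/-- The Schur function `s_μ = ∑_T x^T` over semistandard Young tableaux of shape `μ` (only finitely
many of them contribute to a given monomial). -/
def schur (μ : YoungDiagram) : MvPowerSeries ℕ ℂ :=
  fun m => (Set.ncard {T : SemistandardYoungTableau μ | tableauExponent T = m} : ℂ)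

/-- A set of permutations is Schur-positive if `Q(B)` is a linear combination of Schur functions
with nonnegative coefficients (in particular it is then symmetric). -/
def IsSchurPositive {n : ℕ} (B : Set (Equiv.Perm (Fin n))) : Prop :=
  ∃ c : Shape n → ℝ, (∀ μ, 0 ≤ c μ) ∧ quasiSym B = ∑ μ, (c μ : ℂ) • schur μ.1

/-! ### Irreducible representations of the symmetric group and the Frobenius image -/

/-- A bijective filling of the cells of `μ` with the letters of `Fin n`. -/
def filling {n : ℕ} (μ : Shape n) : {c // c ∈ μ.1.cells} ≃ Fin n :=
  Finset.equivFinOfCardEq μ.2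

/-- The row containing the letter `i` in the chosen filling. -/
def rowOf {n : ℕ} (μ : Shape n) (i : Fin n) : ℕ := ((filling μ).symm i).1.1

/-- The column containing the letter `i` in the chosen filling. -/
def colOf {n : ℕ} (μ : Shape n) (i : Fin n) : ℕ := ((filling μ).symm i).1.2

open Classical in
/-- The sum, in the group algebra, of the permutations that preserve every row of the filling. -/
def rowSum {n : ℕ} (μ : Shape n) : MonoidAlgebra ℂ (Equiv.Perm (Fin n)) :=
  ∑ σ : Equiv.Perm (Fin n) with ∀ i, rowOf μ (σ i) = rowOf μ i, MonoidAlgebra.of ℂ _ σ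

open Classical in
/-- The signed sum, in the group algebra, of the permutations that preserve every column of the
filling. -/
def colSum {n : ℕ} (μ : Shape n) : MonoidAlgebra ℂ (Equiv.Perm (Fin n)) :=
  ∑ σ : Equiv.Perm (Fin n) with ∀ i, colOf μ (σ i) = colOf μ i,
    ((Equiv.Perm.sign σ : ℤ) : ℂ) • MonoidAlgebra.of ℂ _ σ

/-- The Specht module `S^μ`: the left ideal of the group algebra generated by the Young symmetrizer
(row sum times signed column sum). -/
def spechtIdeal {n : ℕ} (μ : Shape n) : Ideal (MonoidAlgebra ℂ (Equiv.Perm (Fin n))) :=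
  Ideal.span {rowSum μ * colSum μ}

/-- The symmetric group acting on the Specht module `S^μ` by left multiplication. -/
def specht {n : ℕ} (μ : Shape n) :
    Representation ℂ (Equiv.Perm (Fin n)) (spechtIdeal μ) :=
  ((Algebra.lsmul ℂ ℂ (spechtIdeal μ) :
      MonoidAlgebra ℂ (Equiv.Perm (Fin n)) →ₐ[ℂ] Module.End ℂ (spechtIdeal μ)) :
    MonoidAlgebra ℂ (Equiv.Perm (Fin n)) →* Module.End ℂ (spechtIdeal μ)).comp
    (MonoidAlgebra.of ℂ (Equiv.Perm (Fin n)))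

/-- The coefficient `c_μ` of the irreducible character `χ^μ` in a class function `χ`, that is,
`⟨χ, χ^μ⟩ = (1/n!) ∑_g χ(g) χ^μ(g⁻¹)`. -/
def multiplicity {n : ℕ} (χ : Equiv.Perm (Fin n) → ℂ) (μ : Shape n) : ℂ :=
  (n.factorial : ℂ)⁻¹ * ∑ g, χ g * (specht μ).character g⁻¹

/-- The Frobenius image `ch(∑_μ c_μ χ^μ) = ∑_μ c_μ s_μ`. -/
def frobeniusImage {n : ℕ} (χ : Equiv.Perm (Fin n) → ℂ) : MvPowerSeries ℕ ℂ :=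
  ∑ μ : Shape n, multiplicity χ μ • schur μ.1

/-- `B` is fine for the representation `ρ` if `ch(χ^ρ) = Q(B)`. -/
def IsFineFor {n : ℕ} {V : Type*} [AddCommGroup V] [Module ℂ V]
    (B : Set (Equiv.Perm (Fin n))) (ρ : Representation ℂ (Equiv.Perm (Fin n)) V) : Prop :=
  frobeniusImage ρ.character = quasiSym B

/-- The partition `(1^n)`, a single column with `n` cells. -/
def oneColumn (n : ℕ) : Shape n :=
  ⟨{ cells := Finset.range n ×ˢ {0}
     isLowerSet := by
      rintro ⟨a, b⟩ ⟨c, d⟩ hle h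
      simp only [Finset.coe_product, Set.mem_prod, Finset.mem_coe, Finset.mem_range,
        Finset.mem_singleton] at h ⊢
      have h1 : c ≤ a := hle.1
      have h2 : d ≤ b := hle.2
      omega }, by
    change (Finset.range n ×ˢ {0}).card = n
    simp⟩

/-! ### Geometric grid classes -/

/-- The segment that an entry of the matrix places in the unit square with lower left corner
`(a, b)`: for the entry `1` the diagonal of slope `1`, for `-1` the diagonal of slope `-1`, for `0`
nothing. -/
def cellSegment (s : SignType) (a b : ℝ) : Set (ℝ × ℝ) :=
  match s with
  | SignType.zero => ∅
  | SignType.pos => segment ℝ (a, b) (a + 1, b + 1)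
  | SignType.neg => segment ℝ (a, b + 1) (a + 1, b)

/-- The grid of a `k × l` matrix with entries in `{0, 1, -1}`, drawn in `[0, l] × [0, k]`. Rows are
listed from top to bottom, so the cell of the entry `(i, j)` has lower left corner
`(j, k - 1 - i)` (zero-based `i`, `j`). -/
def gridFigure {k l : ℕ} (M : Matrix (Fin k) (Fin l) SignType) : Set (ℝ × ℝ) :=
  ⋃ (i : Fin k) (j : Fin l), cellSegment (M i j) (j : ℕ) (i.rev : ℕ)

/-- `G_n(M)`: the permutations obtained by placing `n` dots on the grid, no two of them with the
same `x`- or `y`-coordinate, labelling them by increasing `y`-coordinate and reading the labels by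
increasing `x`-coordinate. Here `p i` is the `i`-th dot from the left and `π i` is its label. -/
def gridClass (n : ℕ) {k l : ℕ} (M : Matrix (Fin k) (Fin l) SignType) :
    Set (Equiv.Perm (Fin n)) :=
  {π | ∃ p : Fin n → ℝ × ℝ, (∀ i, p i ∈ gridFigure M) ∧
    (∀ i j, (p i).1 < (p j).1 ↔ i < j) ∧ (∀ i j, (p i).2 < (p j).2 ↔ π i < π j)}

/-- The matrix of the grid reflected vertically (top and bottom are exchanged). -/
def reflectVer {k l : ℕ} (M : Matrix (Fin k) (Fin l) SignType) : Matrix (Fin k) (Fin l) SignType :=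
  fun i j => -M i.rev j

/-- The matrix of the grid reflected horizontally (left and right are exchanged). -/
def reflectHor {k l : ℕ} (M : Matrix (Fin k) (Fin l) SignType) : Matrix (Fin k) (Fin l) SignType :=
  fun i j => -M i j.rev

/-- The matrix of the grid rotated by 180 degrees. -/
def rotate180 {k l : ℕ} (M : Matrix (Fin k) (Fin l) SignType) : Matrix (Fin k) (Fin l) SignType :=
  fun i j => M i.rev j.rev

theorem cellSegment_neg_ver (s : SignType) (a b c : ℝ) :
    cellSegment (-s) a (c - 1 - b) = (fun q : ℝ × ℝ => (q.1, c - q.2)) ⁻¹' cellSegment s a b := by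
  ext ⟨x, y⟩
  cases s
  · rfl
  · change (x, y) ∈ segment ℝ (a, c - 1 - b) (a + 1, c - 1 - b + 1) ↔
      (x, c - y) ∈ segment ℝ (a, b + 1) (a + 1, b)
    simp only [segment, Set.mem_ofPred_eq, Prod.smul_mk, Prod.mk_add_mk, Prod.mk.injEq, smul_eq_mul]
    constructor <;> rintro ⟨u, v, hu, hv, huv, h1, h2⟩ <;> refine ⟨u, v, hu, hv, huv, h1, ?_⟩ <;>
      linear_combination -h2 + c * huv
  · change (x, y) ∈ segment ℝ (a, c - 1 - b + 1) (a + 1, c - 1 - b) ↔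
      (x, c - y) ∈ segment ℝ (a, b) (a + 1, b + 1)
    simp only [segment, Set.mem_ofPred_eq, Prod.smul_mk, Prod.mk_add_mk, Prod.mk.injEq, smul_eq_mul]
    constructor <;> rintro ⟨u, v, hu, hv, huv, h1, h2⟩ <;> refine ⟨u, v, hu, hv, huv, h1, ?_⟩ <;>
      linear_combination -h2 + c * huv

theorem cellSegment_neg_hor (s : SignType) (a b c : ℝ) :
    cellSegment (-s) (c - 1 - a) b = (fun q : ℝ × ℝ => (c - q.1, q.2)) ⁻¹' cellSegment s a b := by
  ext ⟨x, y⟩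
  cases s
  · rfl
  · change (x, y) ∈ segment ℝ (c - 1 - a, b) (c - 1 - a + 1, b + 1) ↔
      (c - x, y) ∈ segment ℝ (a, b + 1) (a + 1, b)
    rw [segment_symm]
    simp only [segment, Set.mem_ofPred_eq, Prod.smul_mk, Prod.mk_add_mk, Prod.mk.injEq, smul_eq_mul]
    constructor <;> rintro ⟨u, v, hu, hv, huv, h1, h2⟩ <;> refine ⟨u, v, hu, hv, huv, ?_, h2⟩ <;>
      linear_combination -h1 + c * huv
  · change (x, y) ∈ segment ℝ (c - 1 - a, b + 1) (c - 1 - a + 1, b) ↔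
      (c - x, y) ∈ segment ℝ (a, b) (a + 1, b + 1)
    rw [segment_symm]
    simp only [segment, Set.mem_ofPred_eq, Prod.smul_mk, Prod.mk_add_mk, Prod.mk.injEq, smul_eq_mul]
    constructor <;> rintro ⟨u, v, hu, hv, huv, h1, h2⟩ <;> refine ⟨u, v, hu, hv, huv, ?_, h2⟩ <;>
      linear_combination -h1 + c * huv

theorem cast_rev {k : ℕ} (i : Fin k) : ((i.rev : ℕ) : ℝ) = k - 1 - (i : ℕ) := by
  rw [Fin.val_rev, Nat.cast_sub i.2]
  push_cast
  ring

/-- The grid of `reflectVer M` is the mirror image of the grid of `M` in the horizontal line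
`y = k / 2`. -/
theorem gridFigure_reflectVer {k l : ℕ} (M : Matrix (Fin k) (Fin l) SignType) :
    gridFigure (reflectVer M) = (fun q : ℝ × ℝ => (q.1, k - q.2)) ⁻¹' gridFigure M := by
  simp only [gridFigure, Set.preimage_iUnion, reflectVer]
  rw [← Fin.revPerm.surjective.iUnion_comp]
  refine Set.iUnion_congr fun i => Set.iUnion_congr fun j => ?_
  rw [← cellSegment_neg_ver, Fin.revPerm_apply, Fin.rev_rev, ← cast_rev, Fin.rev_rev]

/-- The grid of `reflectHor M` is the mirror image of the grid of `M` in the vertical line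
`x = l / 2`. -/
theorem gridFigure_reflectHor {k l : ℕ} (M : Matrix (Fin k) (Fin l) SignType) :
    gridFigure (reflectHor M) = (fun q : ℝ × ℝ => (l - q.1, q.2)) ⁻¹' gridFigure M := by
  simp only [gridFigure, Set.preimage_iUnion, reflectHor]
  refine Set.iUnion_congr fun i => ?_
  rw [← Fin.revPerm.surjective.iUnion_comp]
  refine Set.iUnion_congr fun j => ?_
  rw [← cellSegment_neg_hor, Fin.revPerm_apply, Fin.rev_rev, ← cast_rev]

/-- The grid of `rotate180 M` is the grid of `M` rotated by 180 degrees about its centre. -/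
theorem gridFigure_rotate180 {k l : ℕ} (M : Matrix (Fin k) (Fin l) SignType) :
    gridFigure (rotate180 M) = (fun q : ℝ × ℝ => (l - q.1, k - q.2)) ⁻¹' gridFigure M := by
  have h : rotate180 M = reflectHor (reflectVer M) := by
    funext i j
    exact (neg_neg _).symm
  rw [h, gridFigure_reflectHor, gridFigure_reflectVer]
  rfl

end GridReflections

end

open GridReflections

namespace GridReflections

/-! ### Linear independence of the fundamental quasisymmetric functions -/

/-! The proof shows that on both the permutation side and the representation side each reflection
replaces every partition by its conjugate.

Permutations. A vertical reflection of the grid reverses the labels and so complements descent sets.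
A horizontal reflection reverses the reading order and so complements and mirrors them. The
functions F_{n,D} are linearly independent (`fundamentalQSym_linearIndependent`), so each operation
on descent sets induces a well-defined linear operation on their span, and it suffices to see what
that does to Schur functions. Since s_μ is the sum of F over the descent sets of standard tableaux
(`schur_eq_sum`), and transposing a tableau complements its descent set (`tabDescents_transpose`),
complementation sends s_μ to the Schur function of the conjugate. Mirroring fixes s_μ, because it
amounts to reversing the order of the variables and s_μ is symmetric by the Bender–Knuth involutions
(`schur_eq_sum_revPos`). Hence if Q of the grid class is ∑ c_μ s_μ, then for both reflections it is
the sum with every μ conjugated. A rotation conjugates twice and changes nothing.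

Representations. Tensoring with S^{(1^n)} multiplies the character by the sign, and the Specht
characters of μ and its conjugate differ by the sign (`character_specht_conj`). The coefficients of
the tensor product are therefore those of ρ at conjugate partitions. As coefficients are defined by
the inner product, neither irreducibility nor orthogonality of the Specht characters is needed. -/

theorem wordExponent_eq_toFinsupp {n : ℕ} (i : Fin n → ℕ) :
    wordExponent i = Multiset.toFinsupp (List.ofFn i : Multiset ℕ) := by
  rw [← Fin.univ_val_map, wordExponent]
  have h : (Finset.univ.val.map i : Multiset ℕ) = ∑ j, {i j} := by
    conv_lhs => rw [← Multiset.sum_map_singleton (Finset.univ.val.map i), Multiset.map_map]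
    rfl
  rw [h, map_sum]
  simp

theorem eq_of_monotone_of_wordExponent_eq {n : ℕ} {i j : Fin n → ℕ} (hi : Monotone i)
    (hj : Monotone j) (h : wordExponent i = wordExponent j) : i = j := by
  rw [wordExponent_eq_toFinsupp, wordExponent_eq_toFinsupp] at h
  have h1 : (List.ofFn i).Perm (List.ofFn j) :=
    Multiset.coe_eq_coe.1 (Multiset.toFinsupp.injective h)
  exact List.ofFn_injective (h1.eq_of_sortedLE hi.sortedLE_ofFn hj.sortedLE_ofFn)

open Classical in
/-- The weakly increasing word whose ascents are exactly the positions of `D`. -/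
noncomputable def ascentWord (n : ℕ) (D : Set ℕ) (j : Fin n) : ℕ :=
  ((Finset.range j).filter (· ∈ D)).card

theorem ascentWord_monotone (n : ℕ) (D : Set ℕ) : Monotone (ascentWord n D) := by
  classical
  intro a b h
  exact Finset.card_le_card (Finset.filter_subset_filter _ (Finset.range_mono h))

theorem ascentWord_lt_iff {n : ℕ} (D : Set ℕ) (d : ℕ) (h : d + 1 < n) :
    ascentWord n D ⟨d, Nat.lt_of_succ_lt h⟩ < ascentWord n D ⟨d + 1, h⟩ ↔ d ∈ D := by
  classical
  simp only [ascentWord, Finset.range_add_one, Finset.filter_insert]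
  split_ifs with hd <;> simp [hd]

/-- The set of possible descent sets of permutations of `Fin n`. -/
def positionSets (n : ℕ) : Set (Set ℕ) := {D | ∀ d ∈ D, d + 1 < n}

-- A weakly increasing word is determined by its monomial, so `ascentWord n E` is the only
-- candidate. Its strict steps are exactly the positions of `E` in range, so it is counted precisely
-- when `D ⊆ E`.
open Classical in
theorem fundamentalQSym_wordExponent_ascentWord {n : ℕ} (D E : Set ℕ) (hD : D ∈ positionSets n) :
    fundamentalQSym n D (wordExponent (ascentWord n E)) = if D ⊆ E then 1 else 0 := by
  unfold fundamentalQSym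
  split_ifs with h
  · have : {i : Fin n → ℕ | Monotone i ∧
      (∀ (d : ℕ) (h : d + 1 < n), d ∈ D → i ⟨d, Nat.lt_of_succ_lt h⟩ < i ⟨d + 1, h⟩) ∧
      wordExponent i = wordExponent (ascentWord n E)} = {ascentWord n E} := by
      ext i
      simp only [Set.mem_ofPred_eq, Set.mem_singleton_iff]
      refine ⟨fun hi => eq_of_monotone_of_wordExponent_eq hi.1 (ascentWord_monotone n E) hi.2.2, ?_⟩
      rintro rfl
      exact ⟨ascentWord_monotone n E, fun d hd hdD => (ascentWord_lt_iff E d hd).2 (h hdD), rfl⟩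
    rw [this, Set.ncard_singleton, Nat.cast_one]
  · have : {i : Fin n → ℕ | Monotone i ∧
      (∀ (d : ℕ) (h : d + 1 < n), d ∈ D → i ⟨d, Nat.lt_of_succ_lt h⟩ < i ⟨d + 1, h⟩) ∧
      wordExponent i = wordExponent (ascentWord n E)} = ∅ := by
      rw [Set.eq_empty_iff_forall_notMem]
      rintro i ⟨h1, h2, h3⟩
      obtain rfl := eq_of_monotone_of_wordExponent_eq h1 (ascentWord_monotone n E) h3
      exact h fun d hd => (ascentWord_lt_iff E d (hD d hd)).1 (h2 d (hD d hd) hd)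
    rw [this, Set.ncard_empty, Nat.cast_zero]

theorem sum_smul_apply {ι : Type*} (s : Finset ι) (g : ι → ℂ) (f : ι → MvPowerSeries ℕ ℂ)
    (m : ℕ →₀ ℕ) : (∑ i ∈ s, g i • f i) m = ∑ i ∈ s, g i * f i m :=
  (map_sum (MvPowerSeries.coeff m) _ s).trans rfl

theorem sum_powerSeries_apply {ι : Type*} (s : Finset ι) (f : ι → MvPowerSeries ℕ ℂ)
    (m : ℕ →₀ ℕ) : (∑ i ∈ s, f i) m = ∑ i ∈ s, f i m :=
  (map_sum (MvPowerSeries.coeff m) _ s).trans rfl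

/-- The coefficients at the words `ascentWord n E` form the incidence matrix of inclusion, which is
triangular: an inclusion-minimal `D` with nonzero coefficient is the only term that survives at
`ascentWord n D`. Positions outside the range do not affect F, hence the restriction to
`positionSets n`. -/
theorem fundamentalQSym_linearIndependent (n : ℕ) :
    LinearIndependent ℂ (fun D : positionSets n => fundamentalQSym n D.1) := by
  classical
  rw [linearIndependent_iff']
  intro s g hs
  by_contra! hne
  obtain ⟨D₀, hD₀, hg₀⟩ := hne
  obtain ⟨D, hD⟩ := (s.filter (g · ≠ 0)).exists_minimal ⟨D₀, by simp [hD₀, hg₀]⟩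
  have hD1 := Finset.mem_filter.1 hD.1
  have h := congrFun hs (wordExponent (ascentWord n D.1))
  rw [sum_smul_apply] at h
  rw [Finset.sum_eq_single_of_mem D hD1.1] at h
  · rw [fundamentalQSym_wordExponent_ascentWord _ _ D.2, if_pos subset_rfl, mul_one] at h
    exact hD1.2 h
  · intro E hE hED
    rw [fundamentalQSym_wordExponent_ascentWord _ _ E.2]
    split_ifs with hsub
    · by_cases hgE : g E = 0
      · rw [hgE, zero_mul]
      · exact absurd (le_antisymm hsub (hD.2 (Finset.mem_filter.2 ⟨hE, hgE⟩) hsub))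
          fun h => hED (Subtype.ext h)
    · exact mul_zero _

/-- Independence permits arbitrary values on the F's; the extension from their span to all power
series is an arbitrary choice. -/
theorem exists_linearMap_fundamentalQSym (n : ℕ) (G : Set ℕ → MvPowerSeries ℕ ℂ) :
    ∃ L : MvPowerSeries ℕ ℂ →ₗ[ℂ] MvPowerSeries ℕ ℂ,
      ∀ D ∈ positionSets n, L (fundamentalQSym n D) = G D := by
  have hli := fundamentalQSym_linearIndependent n
  obtain ⟨L, hL⟩ := LinearMap.exists_extend
    ((Module.Basis.span hli).constr ℂ (fun D : positionSets n => G D.1))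
  refine ⟨L, fun D hD => ?_⟩
  have h1 := (Module.Basis.span hli).constr_basis ℂ (fun D : positionSets n => G D.1) ⟨D, hD⟩
  rw [← hL, LinearMap.comp_apply, Submodule.subtype_apply, Module.Basis.span_apply] at h1
  exact h1

/-! ### Descents of reversed permutations and reflected grids -/

/-- The complement of a set of positions among `0, …, n - 2`. -/
def complPos (n : ℕ) (D : Set ℕ) : Set ℕ := {d | d + 1 < n ∧ d ∉ D}

/-- The mirror image of a set of positions among `0, …, n - 2`. -/
def revPos (n : ℕ) (D : Set ℕ) : Set ℕ := {d | d + 1 < n ∧ n - 2 - d ∈ D}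

theorem descentSet_mem_positionSets {n : ℕ} (π : Equiv.Perm (Fin n)) :
    descentSet π ∈ positionSets n := fun _ h => h.1

theorem descentSet_trans_rev {n : ℕ} (π : Equiv.Perm (Fin n)) :
    descentSet (π.trans Fin.revPerm) = complPos n (descentSet π) := by
  ext d
  simp only [descentSet, complPos, Set.mem_ofPred_eq, Equiv.trans_apply, Fin.revPerm_apply,
    Fin.rev_lt_rev]
  constructor
  · rintro ⟨h, h1⟩
    exact ⟨h, fun ⟨_, h2⟩ => lt_asymm h1 h2⟩
  · rintro ⟨h, h1⟩
    refine ⟨h, lt_of_le_of_ne (not_lt.1 fun h2 => h1 ⟨h, h2⟩) fun h2 => ?_⟩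
    have := congrArg Fin.val (π.injective h2)
    simp at this

theorem descentSet_rev_trans {n : ℕ} (π : Equiv.Perm (Fin n)) :
    descentSet (Fin.revPerm.trans π) = revPos n (complPos n (descentSet π)) := by
  ext d
  simp only [descentSet, complPos, revPos, Set.mem_ofPred_eq, Equiv.trans_apply, Fin.revPerm_apply]
  -- Reading backwards turns the adjacent positions d, d + 1 into the adjacent positions n - 2 - d,
  -- n - 1 - d in the opposite order.
  have key : ∀ h : d + 1 < n, ∃ h' : n - 2 - d + 1 < n,
      (Fin.rev ⟨d + 1, h⟩ : Fin n) = ⟨n - 2 - d, Nat.lt_of_succ_lt h'⟩ ∧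
      (Fin.rev ⟨d, Nat.lt_of_succ_lt h⟩ : Fin n) = ⟨n - 2 - d + 1, h'⟩ := by
    intro h
    refine ⟨by omega, Fin.ext ?_, Fin.ext ?_⟩ <;> simp only [Fin.val_rev] <;> omega
  constructor
  · rintro ⟨h, h1⟩
    obtain ⟨h', e1, e2⟩ := key h
    rw [e1, e2] at h1
    exact ⟨h, h', fun ⟨_, h2⟩ => lt_asymm h1 h2⟩
  · rintro ⟨h, h', h1⟩
    obtain ⟨_, e1, e2⟩ := key h
    refine ⟨h, ?_⟩
    rw [e1, e2]
    refine lt_of_le_of_ne (not_lt.1 fun h2 => h1 ⟨h', h2⟩) fun h2 => ?_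
    have := congrArg Fin.val (π.injective h2)
    simp at this

theorem mem_gridClass_reflectVer {n k l : ℕ} {M : Matrix (Fin k) (Fin l) SignType}
    {π : Equiv.Perm (Fin n)} (h : π ∈ gridClass n M) :
    π.trans Fin.revPerm ∈ gridClass n (reflectVer M) := by
  obtain ⟨p, h1, h2, h3⟩ := h
  refine ⟨fun i => ((p i).1, k - (p i).2), fun i => ?_, h2, fun i j => ?_⟩
  · rw [gridFigure_reflectVer]
    simpa using h1 i
  · simp only [Equiv.trans_apply, Fin.revPerm_apply, Fin.rev_lt_rev, ← h3]
    exact sub_lt_sub_iff_left _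

theorem mem_gridClass_reflectHor {n k l : ℕ} {M : Matrix (Fin k) (Fin l) SignType}
    {π : Equiv.Perm (Fin n)} (h : π ∈ gridClass n M) :
    Fin.revPerm.trans π ∈ gridClass n (reflectHor M) := by
  obtain ⟨p, h1, h2, h3⟩ := h
  refine ⟨fun i => (l - (p i.rev).1, (p i.rev).2), fun i => ?_, fun i j => ?_, fun i j => ?_⟩
  · rw [gridFigure_reflectHor]
    simpa using h1 i.rev
  · rw [sub_lt_sub_iff_left, h2, Fin.rev_lt_rev]
  · simpa using h3 i.rev j.rev

theorem reflectVer_reflectVer {k l : ℕ} (M : Matrix (Fin k) (Fin l) SignType) :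
    reflectVer (reflectVer M) = M := by
  funext i j
  simp [reflectVer]

theorem reflectHor_reflectHor {k l : ℕ} (M : Matrix (Fin k) (Fin l) SignType) :
    reflectHor (reflectHor M) = M := by
  funext i j
  simp [reflectHor]

theorem rotate180_eq {k l : ℕ} (M : Matrix (Fin k) (Fin l) SignType) :
    rotate180 M = reflectHor (reflectVer M) := by
  funext i j
  exact (neg_neg _).symm

theorem quasiSym_eq_of_equiv {n : ℕ} {B B' : Set (Equiv.Perm (Fin n))}
    (f : Equiv.Perm (Fin n) → Equiv.Perm (Fin n)) (hf : Function.Involutive f)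
    (h : ∀ π ∈ B, f π ∈ B') (h' : ∀ π ∈ B', f π ∈ B) :
    quasiSym B' = ∑ π ∈ B.toFinite.toFinset, fundamentalQSym n (descentSet (f π)) := by
  unfold quasiSym
  refine Finset.sum_bij' (fun π _ => f π) (fun π _ => f π) ?_ ?_ ?_ ?_ ?_
  · simpa using h'
  · simpa using h
  · intro π _; exact hf π
  · intro π _; exact hf π
  · intro π _; rw [hf π]

theorem quasiSym_gridClass_reflectVer {k l : ℕ} (M : Matrix (Fin k) (Fin l) SignType) (n : ℕ) :
    quasiSym (gridClass n (reflectVer M)) =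
      ∑ π ∈ (gridClass n M).toFinite.toFinset,
        fundamentalQSym n (complPos n (descentSet π)) := by
  rw [quasiSym_eq_of_equiv (B := gridClass n M) (fun π => π.trans Fin.revPerm)]
  · simp only [descentSet_trans_rev]
  · intro π; ext; simp
  · intro π; exact mem_gridClass_reflectVer
  · intro π h
    simpa only [reflectVer_reflectVer] using mem_gridClass_reflectVer h

theorem quasiSym_gridClass_reflectHor {k l : ℕ} (M : Matrix (Fin k) (Fin l) SignType) (n : ℕ) :
    quasiSym (gridClass n (reflectHor M)) =
      ∑ π ∈ (gridClass n M).toFinite.toFinset,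
        fundamentalQSym n (revPos n (complPos n (descentSet π))) := by
  rw [quasiSym_eq_of_equiv (B := gridClass n M) (fun π => Fin.revPerm.trans π)]
  · simp only [descentSet_rev_trans]
  · intro π; ext; simp
  · intro π; exact mem_gridClass_reflectHor
  · intro π h
    simpa only [reflectHor_reflectHor] using mem_gridClass_reflectHor h

/-! ### Standard tableaux and the expansion of Schur functions -/

/-- Standard Young tableaux of shape `μ`, as linear extensions of the poset of cells: `Q j` is the
cell that contains the letter `j`. -/
abbrev StdTab {n : ℕ} (μ : Shape n) : Type :=
  {Q : Fin n ≃ {c // c ∈ μ.1.cells} // ∀ i j, (Q i).1 ≤ (Q j).1 → i ≤ j}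

/-- The descents of a standard tableau: the letters `d` such that `d + 1` lies weakly to the left
of `d`. -/
def tabDescents {n : ℕ} {μ : Shape n} (Q : StdTab μ) : Set ℕ :=
  {d | ∃ h : d + 1 < n, (Q.1 ⟨d + 1, h⟩).1.2 ≤ (Q.1 ⟨d, Nat.lt_of_succ_lt h⟩).1.2}

theorem tabDescents_mem_positionSets {n : ℕ} {μ : Shape n} (Q : StdTab μ) :
    tabDescents Q ∈ positionSets n := fun _ h => h.1

/-- The conjugate partition. -/
def Shape.conj {n : ℕ} (μ : Shape n) : Shape n :=
  ⟨μ.1.transpose, by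
    rw [YoungDiagram.card, YoungDiagram.transpose]
    simpa using μ.2⟩

theorem Shape.conj_conj {n : ℕ} (μ : Shape n) : μ.conj.conj = μ :=
  Subtype.ext μ.1.transpose_transpose

/-- Conjugation as a permutation of the partitions of `n`. -/
def conjEquiv (n : ℕ) : Shape n ≃ Shape n where
  toFun := Shape.conj
  invFun := Shape.conj
  left_inv := Shape.conj_conj
  right_inv := Shape.conj_conj

/-- Reflection of cells in the main diagonal. -/
def swapCells {n : ℕ} (μ : Shape n) : {c // c ∈ μ.1.cells} ≃ {c // c ∈ μ.conj.1.cells} where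
  toFun c := ⟨c.1.swap, by simp [Shape.conj, YoungDiagram.mem_transpose]⟩
  invFun c := ⟨c.1.swap, by
    have := c.2
    simpa [Shape.conj, YoungDiagram.mem_transpose] using this⟩
  left_inv c := by simp
  right_inv c := by simp

/-- Transposition of standard tableaux. -/
def StdTab.transpose {n : ℕ} {μ : Shape n} (Q : StdTab μ) : StdTab μ.conj :=
  ⟨Q.1.trans (swapCells μ), fun i j h => Q.2 i j (Prod.swap_le_swap.1 h)⟩

theorem StdTab.transpose_bijective {n : ℕ} (μ : Shape n) :
    Function.Bijective (StdTab.transpose (μ := μ)) := by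
  constructor
  · intro Q Q' h
    refine Subtype.ext (Equiv.ext fun i => (swapCells μ).injective ?_)
    exact congrArg (fun R : StdTab μ.conj => R.1 i) h
  · intro R
    refine ⟨⟨R.1.trans (swapCells μ).symm, fun i j h => R.2 i j (Prod.swap_le_swap.1 h)⟩, ?_⟩
    refine Subtype.ext (Equiv.ext fun i => ?_)
    simp [StdTab.transpose]

/-- The letter d + 1 lies either strictly right of and weakly above d, or strictly below and weakly
left of it; transposition exchanges the two cases. -/
theorem tabDescents_transpose {n : ℕ} {μ : Shape n} (Q : StdTab μ) :
    tabDescents Q.transpose = complPos n (tabDescents Q) := by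
  ext d
  have key : ∀ h : d + 1 < n,
      (Q.1 ⟨d + 1, h⟩).1.1 ≤ (Q.1 ⟨d, Nat.lt_of_succ_lt h⟩).1.1 ↔
      ¬ (Q.1 ⟨d + 1, h⟩).1.2 ≤ (Q.1 ⟨d, Nat.lt_of_succ_lt h⟩).1.2 := by
    intro h
    set a := Q.1 ⟨d, Nat.lt_of_succ_lt h⟩ with ha
    set b := Q.1 ⟨d + 1, h⟩ with hb
    constructor
    · intro h1 h2
      have := Q.2 ⟨d + 1, h⟩ ⟨d, Nat.lt_of_succ_lt h⟩ ⟨h1, h2⟩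
      simp [Fin.le_def] at this
    · intro h2
      by_contra h1
      push Not at h1 h2
      -- If d + 1 were strictly below and strictly right of d, the corner cell in the row of d and
      -- the column of d + 1 would need a letter strictly between the two.
      have hm : (a.1.1, b.1.2) ∈ μ.1.cells := μ.1.up_left_mem h1.le le_rfl b.2
      obtain ⟨e, he⟩ := Q.1.surjective ⟨_, hm⟩
      have hc : (Q.1 e).1 = (a.1.1, b.1.2) := by rw [he]
      have h3 := Q.2 ⟨d, Nat.lt_of_succ_lt h⟩ e (by rw [hc]; exact ⟨le_rfl, h2.le⟩)
      have h4 := Q.2 e ⟨d + 1, h⟩ (by rw [hc]; exact ⟨h1.le, le_rfl⟩)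
      have h5 : (e : ℕ) = d ∨ (e : ℕ) = d + 1 := by
        simp only [Fin.le_def] at h3 h4
        omega
      rcases h5 with h5 | h5
      · have : e = ⟨d, Nat.lt_of_succ_lt h⟩ := Fin.ext h5
        rw [this, ← ha] at hc
        have := congrArg Prod.snd hc
        simp only at this
        omega
      · have : e = ⟨d + 1, h⟩ := Fin.ext h5
        rw [this, ← hb] at hc
        have := congrArg Prod.fst hc
        simp only at this
        omega
  constructor
  · rintro ⟨h, h1⟩
    exact ⟨h, fun ⟨_, h2⟩ => (key h).1 h1 h2⟩
  · rintro ⟨h, h1⟩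
    exact ⟨h, (key h).2 fun h2 => h1 ⟨h, h2⟩⟩

/-- The weakly increasing words that increase strictly at the positions of `D`. -/
def IsCompatible {n : ℕ} (D : Set ℕ) (i : Fin n → ℕ) : Prop :=
  Monotone i ∧ ∀ (d : ℕ) (h : d + 1 < n), d ∈ D → i ⟨d, Nat.lt_of_succ_lt h⟩ < i ⟨d + 1, h⟩

/-- Monotonicity makes `w` constant from i to j, so no position in between is a descent and each
successive letter moves strictly to the right. -/
theorem col_lt_of_compatible {n : ℕ} {μ : Shape n} (Q : StdTab μ) {w : Fin n → ℕ}
    (hw : IsCompatible (tabDescents Q) w) {i j : Fin n} (hij : i < j) (h : w i = w j) :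
    (Q.1 i).1.2 < (Q.1 j).1.2 := by
  obtain ⟨i, hi⟩ := i
  obtain ⟨j, hj⟩ := j
  have hij' : i < j := hij
  clear hij
  induction j with
  | zero => omega
  | succ j ih =>
    have hj' : j < n := by omega
    have h1 : w ⟨i, hi⟩ ≤ w ⟨j, hj'⟩ := hw.1 (Fin.mk_le_mk.2 (by omega))
    have h2 : w ⟨j, hj'⟩ ≤ w ⟨j + 1, hj⟩ := hw.1 (Fin.mk_le_mk.2 (by omega))
    have h3 : (Q.1 ⟨j, hj'⟩).1.2 < (Q.1 ⟨j + 1, hj⟩).1.2 := by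
      by_contra hcon
      have := hw.2 j hj ⟨hj, not_lt.1 hcon⟩
      omega
    rcases Nat.lt_succ_iff_lt_or_eq.1 hij' with h4 | h4
    · exact (ih hj' (by omega) h4).trans h3
    · subst h4
      exact h3

open Classical in
/-- The semistandard tableau obtained from a standard tableau `Q` by replacing the letter `j` by
`w j`. -/
noncomputable def destandardize {n : ℕ} {μ : Shape n} (Q : StdTab μ) (w : Fin n → ℕ)
    (hw : IsCompatible (tabDescents Q) w) : SemistandardYoungTableau μ.1 where
  entry r c := if h : (r, c) ∈ μ.1.cells then w (Q.1.symm ⟨(r, c), h⟩) else 0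
  row_weak' := by
    intro r c c' hc h
    have h' : (r, c) ∈ μ.1.cells := μ.1.up_left_mem le_rfl hc.le h
    rw [dif_pos h', dif_pos (show (r, c') ∈ μ.1.cells from h)]
    refine hw.1 (Q.2 _ _ ?_)
    simp only [Equiv.apply_symm_apply]
    exact ⟨le_rfl, hc.le⟩
  col_strict' := by
    intro r r' c hr h
    have h' : (r, c) ∈ μ.1.cells := μ.1.up_left_mem hr.le le_rfl h
    rw [dif_pos h', dif_pos (show (r', c) ∈ μ.1.cells from h)]
    have hle : Q.1.symm ⟨(r, c), h'⟩ ≤ Q.1.symm ⟨(r', c), h⟩ := by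
      refine Q.2 _ _ ?_
      simp only [Equiv.apply_symm_apply]
      exact ⟨hr.le, le_rfl⟩
    have hne : Q.1.symm ⟨(r, c), h'⟩ ≠ Q.1.symm ⟨(r', c), h⟩ := by
      intro he
      have := congrArg (fun x => x.1.1) (Q.1.symm.injective he)
      simp only at this
      omega
    -- Equal values would put the two letters in different columns, but both lie in column `c`.
    refine lt_of_le_of_ne (hw.1 hle) fun he => ?_
    have := col_lt_of_compatible Q hw (lt_of_le_of_ne hle hne) he
    simp at this
  zeros' := by
    intro r c h
    exact dif_neg h

theorem destandardize_apply {n : ℕ} {μ : Shape n} (Q : StdTab μ) (w : Fin n → ℕ)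
    (hw : IsCompatible (tabDescents Q) w) (j : Fin n) :
    destandardize Q w hw (Q.1 j).1.1 (Q.1 j).1.2 = w j := by
  refine (dif_pos (Q.1 j).2).trans ?_
  simp

theorem tableauExponent_eq_wordExponent {n : ℕ} {μ : Shape n} (T : SemistandardYoungTableau μ.1)
    (e : Fin n ≃ {c // c ∈ μ.1.cells}) :
    tableauExponent T = wordExponent (fun j => T (e j).1.1 (e j).1.2) := by
  unfold tableauExponent wordExponent
  rw [← Finset.sum_coe_sort μ.1.cells (fun c => Finsupp.single (T c.1 c.2) 1), ← e.sum_comp]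

/-- The letters of a semistandard tableau are standardized by value, then by column. -/
def cellKey {μ : YoungDiagram} (T : SemistandardYoungTableau μ) (c : {c // c ∈ μ.cells}) :
    ℕ ×ₗ ℕ := toLex (T c.1.1 c.1.2, c.1.2)

theorem cellKey_injective {μ : YoungDiagram} (T : SemistandardYoungTableau μ) :
    Function.Injective (cellKey T) := by
  rintro ⟨⟨r, c⟩, h⟩ ⟨⟨r', c'⟩, h'⟩ he
  have he' := toLex.injective he
  simp only [Prod.mk.injEq] at he'
  obtain ⟨h1, rfl⟩ := he'
  rcases lt_trichotomy r r' with hr | rfl | hr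
  · exact absurd h1 (T.col_strict hr h').ne
  · rfl
  · exact absurd h1 (T.col_strict hr h).ne'

theorem exists_equiv_strictMono {α β : Type*} [Fintype α] [LinearOrder β] {n : ℕ}
    (hn : Fintype.card α = n) (key : α → β) (hkey : Function.Injective key) :
    ∃ e : Fin n ≃ α, StrictMono (key ∘ e) := by
  let _ : LinearOrder α := LinearOrder.lift' key hkey
  exact ⟨(Fintype.orderIsoFinOfCardEq α hn).toEquiv,
    fun i j h => (Fintype.orderIsoFinOfCardEq α hn).strictMono h⟩

theorem strictMono_cellKey {n : ℕ} {μ : Shape n} (Q : StdTab μ) (w : Fin n → ℕ)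
    (hw : IsCompatible (tabDescents Q) w) :
    StrictMono (cellKey (destandardize Q w hw) ∘ Q.1) := by
  intro i j hij
  simp only [Function.comp_apply, cellKey, destandardize_apply]
  rw [Prod.Lex.toLex_lt_toLex]
  rcases (hw.1 hij.le).lt_or_eq with h | h
  · exact Or.inl h
  · exact Or.inr ⟨h, col_lt_of_compatible Q hw hij h⟩

/-- Standardization: list the cells by increasing `cellKey` and let `w` read off the entries. Ties
are broken from left to right, so an equality between consecutive entries never occurs at a descent.
-/
theorem exists_destandardize_eq {n : ℕ} {μ : Shape n} (T : SemistandardYoungTableau μ.1) :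
    ∃ (Q : StdTab μ) (w : Fin n → ℕ) (hw : IsCompatible (tabDescents Q) w),
      destandardize Q w hw = T := by
  obtain ⟨e, he⟩ := exists_equiv_strictMono (n := n)
    (by rw [Fintype.card_coe]; exact μ.2) (cellKey T) (cellKey_injective T)
  have hext : ∀ i j, (e i).1 ≤ (e j).1 → i ≤ j := by
    intro i j hle
    rw [← he.le_iff_le]
    simp only [Function.comp_apply, cellKey]
    rw [Prod.Lex.toLex_le_toLex]
    have h1 : T (e i).1.1 (e i).1.2 ≤ T (e i).1.1 (e j).1.2 :=
      T.row_weak_of_le hle.2 (μ.1.up_left_mem hle.1 le_rfl (e j).2)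
    have h2 : T (e i).1.1 (e j).1.2 ≤ T (e j).1.1 (e j).1.2 := T.col_weak hle.1 (e j).2
    rcases (h1.trans h2).lt_or_eq with h | h
    · exact Or.inl h
    · exact Or.inr ⟨h, hle.2⟩
  have hmono : ∀ {i j}, i ≤ j → T (e i).1.1 (e i).1.2 ≤ T (e j).1.1 (e j).1.2 := by
    intro i j hij
    have := he.monotone hij
    simp only [Function.comp_apply, cellKey] at this
    rw [Prod.Lex.toLex_le_toLex] at this
    exact this.elim le_of_lt fun h => h.1.le
  have hw : IsCompatible (tabDescents (⟨e, hext⟩ : StdTab μ))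
      (fun j => T (e j).1.1 (e j).1.2) := by
    refine ⟨fun i j => hmono, ?_⟩
    rintro d h ⟨_, hd⟩
    have := he (show (⟨d, Nat.lt_of_succ_lt h⟩ : Fin n) < ⟨d + 1, h⟩ from Nat.lt_succ_self d)
    simp only [Function.comp_apply, cellKey] at this
    rw [Prod.Lex.toLex_lt_toLex] at this
    exact this.resolve_right fun h' => absurd h'.2 (not_lt.2 hd)
  refine ⟨⟨e, hext⟩, _, hw, ?_⟩
  ext r c
  by_cases h : (r, c) ∈ μ.1.cells
  · obtain ⟨j, hj⟩ := e.surjective ⟨(r, c), h⟩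
    have := destandardize_apply (⟨e, hext⟩ : StdTab μ) _ hw j
    simpa only [hj] using this
  · rw [SemistandardYoungTableau.zeros _ h, SemistandardYoungTableau.zeros _ h]

theorem wordExponent_apply_ne_zero {n : ℕ} (i : Fin n → ℕ) (j : Fin n) :
    wordExponent i (i j) ≠ 0 := by
  rw [wordExponent, Finsupp.finsetSum_apply]
  refine (Finset.sum_pos' (fun _ _ => Nat.zero_le _) ⟨j, Finset.mem_univ _, ?_⟩).ne'
  simp

theorem finite_compatible {n : ℕ} (D : Set ℕ) (m : ℕ →₀ ℕ) :
    Finite {i : Fin n → ℕ // IsCompatible D i ∧ wordExponent i = m} := by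
  refine Finite.of_injective
    (fun i => (fun j => ⟨i.1 j, ?_⟩ : Fin n → {v // v ∈ m.support})) ?_
  · obtain ⟨i, _, rfl⟩ := i
    exact Finsupp.mem_support_iff.2 (wordExponent_apply_ne_zero i j)
  · intro i i' h
    refine Subtype.ext (funext fun j => ?_)
    exact congrArg Subtype.val (congrFun h j)

instance finiteStdTab {n : ℕ} (μ : Shape n) : Finite (StdTab μ) :=
  Subtype.finite

noncomputable instance fintypeStdTab {n : ℕ} (μ : Shape n) : Fintype (StdTab μ) :=
  Fintype.ofFinite _

/-- A Schur function is the sum of the fundamental quasisymmetric functions of the descent sets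
of the standard tableaux. -/
theorem schur_eq_sum {n : ℕ} (μ : Shape n) :
    schur μ.1 = ∑ Q : StdTab μ, fundamentalQSym n (tabDescents Q) := by
  funext m
  rw [sum_powerSeries_apply]
  have hF : ∀ Q : StdTab μ, fundamentalQSym n (tabDescents Q) m =
      (Nat.card {i : Fin n → ℕ // IsCompatible (tabDescents Q) i ∧ wordExponent i = m} : ℂ) := by
    intro Q
    unfold fundamentalQSym IsCompatible
    simp only [and_assoc]
    rfl
  simp only [hF]
  rw [← Nat.cast_sum]
  have := fun Q : StdTab μ => finite_compatible (n := n) (tabDescents Q) m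
  rw [← Nat.card_sigma]
  unfold schur
  rw [← Nat.card_coe_set_eq]
  congr 1
  symm
  refine Nat.card_eq_of_bijective
    (fun x => ⟨destandardize x.1 x.2.1 x.2.2.1, ?_⟩) ⟨?_, ?_⟩
  · obtain ⟨Q, w, hw, rfl⟩ := x
    rw [Set.mem_ofPred_eq, tableauExponent_eq_wordExponent _ Q.1]
    simp only [destandardize_apply]
  · rintro ⟨Q, w, hw, _⟩ ⟨Q', w', hw', _⟩ h
    have hT : destandardize Q w hw = destandardize Q' w' hw' := congrArg Subtype.val h
    have h1 := strictMono_cellKey Q w hw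
    have h2 := strictMono_cellKey Q' w' hw'
    rw [← hT] at h2
    have hQ : Q = Q' := by
      -- The standard tableau is recovered from its image as the unique enumeration of the cells
      -- with increasing keys: two strictly increasing sequences with the same range agree.
      refine Subtype.ext (Equiv.ext fun i => cellKey_injective (destandardize Q w hw) ?_)
      refine congrFun ((StrictMono.range_inj h1 h2).1 ?_) i
      rw [Q.1.surjective.range_comp, Q'.1.surjective.range_comp]
    subst hQ
    have hww : w = w' := by
      funext j
      rw [← destandardize_apply Q w hw j, hT, destandardize_apply]
    subst hww
    rfl
  · rintro ⟨T, hT⟩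
    obtain ⟨Q, w, hw, rfl⟩ := exists_destandardize_eq T
    refine ⟨⟨Q, w, hw, ?_⟩, rfl⟩
    rw [← hT, tableauExponent_eq_wordExponent _ Q.1]
    simp only [destandardize_apply]

/-- The Schur function of the conjugate partition is obtained by complementing descent sets. -/
theorem schur_conj_eq_sum {n : ℕ} (μ : Shape n) :
    schur μ.conj.1 = ∑ Q : StdTab μ, fundamentalQSym n (complPos n (tabDescents Q)) := by
  rw [schur_eq_sum]
  symm
  refine Fintype.sum_bijective StdTab.transpose (StdTab.transpose_bijective μ) _ _ fun Q => ?_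
  rw [tabDescents_transpose]

/-! ### Bender–Knuth involutions and the symmetry of Schur functions -/

theorem mem_iff_lt_card_of_lower {s : Finset ℕ} (hs : ∀ a ∈ s, ∀ b ≤ a, b ∈ s) (c : ℕ) :
    c ∈ s ↔ c < s.card := by
  constructor
  · intro h
    have : Finset.range (c + 1) ⊆ s := fun b hb =>
      hs c h b (Nat.lt_succ_iff.1 (Finset.mem_range.1 hb))
    simpa using Finset.card_le_card this
  · intro h
    by_contra hc
    have : s ⊆ Finset.range c := by
      intro a ha
      rw [Finset.mem_range]
      by_contra hac
      exact hc (hs a ha c (not_lt.1 hac))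
    have := Finset.card_le_card this
    simp only [Finset.card_range] at this
    omega

section Pattern

variable {μ : YoungDiagram}

/-- The number of entries smaller than `v` in row `r` of `T`. -/
def lenBelow (T : SemistandardYoungTableau μ) (v r : ℕ) : ℕ :=
  ((Finset.range (μ.rowLen r)).filter (T r · < v)).card

theorem lenBelow_le_rowLen (T : SemistandardYoungTableau μ) (v r : ℕ) :
    lenBelow T v r ≤ μ.rowLen r := by
  rw [lenBelow]
  simpa using Finset.card_filter_le (Finset.range (μ.rowLen r)) (T r · < v)

theorem lt_lenBelow_iff (T : SemistandardYoungTableau μ) (v r c : ℕ) :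
    c < lenBelow T v r ↔ c < μ.rowLen r ∧ T r c < v := by
  unfold lenBelow
  rw [← mem_iff_lt_card_of_lower, Finset.mem_filter, Finset.mem_range]
  intro a ha b hb
  rw [Finset.mem_filter, Finset.mem_range] at ha ⊢
  exact ⟨hb.trans_lt ha.1,
    (T.row_weak_of_le hb (YoungDiagram.mem_iff_lt_rowLen.2 ha.1)).trans_lt ha.2⟩

theorem lenBelow_eq {T : SemistandardYoungTableau μ} {v r k : ℕ}
    (h : ∀ c, c < k ↔ c < μ.rowLen r ∧ T r c < v) : lenBelow T v r = k := by
  refine eq_of_forall_lt_iff fun c => ?_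
  rw [lt_lenBelow_iff, h]

theorem lenBelow_mono (T : SemistandardYoungTableau μ) {v w : ℕ} (h : v ≤ w) (r : ℕ) :
    lenBelow T v r ≤ lenBelow T w r := by
  refine le_of_forall_lt fun c hc => ?_
  rw [lt_lenBelow_iff] at hc ⊢
  exact ⟨hc.1, hc.2.trans_le h⟩

/-- By column strictness, above an entry at most v stands an entry less than v. With `lenBelow_mono`
this is the interlacing of a Gelfand–Tsetlin pattern. -/
theorem lenBelow_succ_le (T : SemistandardYoungTableau μ) (v r : ℕ) :
    lenBelow T (v + 1) (r + 1) ≤ lenBelow T v r := by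
  refine le_of_forall_lt fun c hc => ?_
  rw [lt_lenBelow_iff] at hc ⊢
  have := T.col_strict (Nat.lt_add_one r) (YoungDiagram.mem_iff_lt_rowLen.2 hc.1)
  exact ⟨hc.1.trans_le (μ.rowLen_anti r (r + 1) (Nat.le_succ r)), by omega⟩

theorem tableauExponent_add_sum (T : SemistandardYoungTableau μ) (v : ℕ) :
    tableauExponent T v + ∑ r ∈ Finset.range (μ.colLen 0), lenBelow T v r =
      ∑ r ∈ Finset.range (μ.colLen 0), lenBelow T (v + 1) r := by
  have h : tableauExponent T v = ∑ r ∈ Finset.range (μ.colLen 0),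
      ∑ c ∈ Finset.range (μ.rowLen r), if T r c = v then 1 else 0 := by
    unfold tableauExponent
    rw [Finsupp.finsetSum_apply,
      Finset.sum_finset_product μ.cells (Finset.range (μ.colLen 0))
        (fun r => Finset.range (μ.rowLen r))]
    · simp only [Finsupp.single_apply]
    · rintro ⟨r, c⟩
      simp only [YoungDiagram.mem_cells, Finset.mem_range, ← YoungDiagram.mem_iff_lt_rowLen,
        ← YoungDiagram.mem_iff_lt_colLen]
      exact ⟨fun hc => ⟨μ.up_left_mem le_rfl (Nat.zero_le _) hc, hc⟩, fun hc => hc.2⟩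
  rw [h, ← Finset.sum_add_distrib]
  refine Finset.sum_congr rfl fun r _ => ?_
  unfold lenBelow
  rw [Finset.card_filter, Finset.card_filter, ← Finset.sum_add_distrib]
  refine Finset.sum_congr rfl fun c _ => ?_
  split_ifs <;> omega

/-- The least possible row lengths between two row-length sequences. -/
def lowerLen (a b : ℕ → ℕ) (r : ℕ) : ℕ := max (a r) (b (r + 1))

/-- The greatest possible row lengths between two row-length sequences. -/
def upperLen (a b : ℕ → ℕ) : ℕ → ℕ
  | 0 => b 0
  | r + 1 => min (b (r + 1)) (a r)

/-- The lower bound of row R and the upper bound of row R + 1 are the maximum and the minimum of the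
same two numbers, so the sum telescopes. -/
theorem sum_lowerLen_add_upperLen (a b : ℕ → ℕ) (R : ℕ) :
    ∑ r ∈ Finset.range R, (lowerLen a b r + upperLen a b r) + upperLen a b R =
      ∑ r ∈ Finset.range R, (a r + b r) + b R := by
  induction R with
  | zero => rfl
  | succ R ih =>
    rw [Finset.sum_range_succ, Finset.sum_range_succ]
    have h : lowerLen a b R + upperLen a b (R + 1) = a R + b (R + 1) := by
      simp only [lowerLen, upperLen]
      omega
    omega

variable (T : SemistandardYoungTableau μ) (j : ℕ)

/-- The new number of entries at most `j` in row `r` after the Bender–Knuth move. -/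
def toggledLen (r : ℕ) : ℕ :=
  lowerLen (lenBelow T j) (lenBelow T (j + 2)) r + upperLen (lenBelow T j) (lenBelow T (j + 2)) r -
    lenBelow T (j + 1) r

/-- Interlacing confines the middle row length to an interval that depends only on the outer two
sequences. The Bender–Knuth move reflects it in this interval, so the subtraction in `toggledLen`
never truncates. -/
theorem lowerLen_le (r : ℕ) :
    lowerLen (lenBelow T j) (lenBelow T (j + 2)) r ≤ lenBelow T (j + 1) r :=
  max_le (lenBelow_mono T (Nat.le_succ j) r) (lenBelow_succ_le T (j + 1) r)

theorem le_upperLen (r : ℕ) :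
    lenBelow T (j + 1) r ≤ upperLen (lenBelow T j) (lenBelow T (j + 2)) r := by
  cases r with
  | zero => exact lenBelow_mono T (Nat.le_succ (j + 1)) 0
  | succ r => exact le_min (lenBelow_mono T (Nat.le_succ (j + 1)) _) (lenBelow_succ_le T j r)

theorem lowerLen_le_toggledLen (r : ℕ) :
    lowerLen (lenBelow T j) (lenBelow T (j + 2)) r ≤ toggledLen T j r := by
  have := le_upperLen T j r
  unfold toggledLen
  omega

theorem toggledLen_le_upperLen (r : ℕ) :
    toggledLen T j r ≤ upperLen (lenBelow T j) (lenBelow T (j + 2)) r := by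
  have := lowerLen_le T j r
  unfold toggledLen
  omega

theorem le_toggledLen (r : ℕ) : lenBelow T j r ≤ toggledLen T j r :=
  (le_max_left _ _).trans (lowerLen_le_toggledLen T j r)

theorem toggledLen_le (r : ℕ) : toggledLen T j r ≤ lenBelow T (j + 2) r := by
  refine (toggledLen_le_upperLen T j r).trans ?_
  cases r with
  | zero => exact le_rfl
  | succ r => exact min_le_left _ _

theorem le_toggledLen_of_succ (r : ℕ) : lenBelow T (j + 2) (r + 1) ≤ toggledLen T j r :=
  (le_max_right _ _).trans (lowerLen_le_toggledLen T j r)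

theorem toggledLen_succ_le (r : ℕ) : toggledLen T j (r + 1) ≤ lenBelow T j r :=
  (toggledLen_le_upperLen T j (r + 1)).trans (min_le_right _ _)

/-- The entries of the tableau after the Bender–Knuth move that exchanges the multiplicities of `j`
and `j + 1`. -/
def benderKnuthEntry (r c : ℕ) : ℕ :=
  if lenBelow T j r ≤ c ∧ c < lenBelow T (j + 2) r then
    if c < toggledLen T j r then j else j + 1
  else T r c

/-- If both cells hold a rewritten entry, the interlacing bounds `h5` and `h6` force j above j + 1.
If only one does, the other entry is below j or at least j + 2 and stays on the correct side. -/
theorem benderKnuthEntry_lt_succ (r c : ℕ) (h : (r + 1, c) ∈ μ) :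
    benderKnuthEntry T j r c < benderKnuthEntry T j (r + 1) c := by
  have h' : (r, c) ∈ μ := μ.up_left_mem (Nat.le_succ r) le_rfl h
  have hlt := T.col_strict (Nat.lt_add_one r) h
  have h1 := lt_lenBelow_iff T j r c
  have h2 := lt_lenBelow_iff T (j + 2) r c
  have h3 := lt_lenBelow_iff T j (r + 1) c
  have h4 := lt_lenBelow_iff T (j + 2) (r + 1) c
  rw [← YoungDiagram.mem_iff_lt_rowLen] at h1 h2 h3 h4
  simp only [h, h', true_and] at h1 h2 h3 h4
  have h5 := le_toggledLen_of_succ T j r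
  have h6 := toggledLen_succ_le T j r
  unfold benderKnuthEntry
  split_ifs <;> omega

/-- The Bender–Knuth involution exchanging the multiplicities of `j` and `j + 1`. -/
def benderKnuth : SemistandardYoungTableau μ where
  entry := benderKnuthEntry T j
  row_weak' := by
    intro r c c' hc h
    have h' : (r, c) ∈ μ := μ.up_left_mem le_rfl hc.le h
    have hle := T.row_weak hc h
    have h1 := lt_lenBelow_iff T j r c
    have h2 := lt_lenBelow_iff T (j + 2) r c
    have h3 := lt_lenBelow_iff T j r c'
    have h4 := lt_lenBelow_iff T (j + 2) r c'
    rw [← YoungDiagram.mem_iff_lt_rowLen] at h1 h2 h3 h4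
    simp only [h, h', true_and] at h1 h2 h3 h4
    unfold benderKnuthEntry
    split_ifs <;> omega
  col_strict' := by
    intro r r' c hr h
    induction r', hr using Nat.le_induction with
    | base => exact benderKnuthEntry_lt_succ T j r c h
    | succ r' _ ih =>
      exact (ih (μ.up_left_mem (Nat.le_succ r') le_rfl h)).trans
        (benderKnuthEntry_lt_succ T j r' c h)
  zeros' := by
    intro r c h
    have h2 := lt_lenBelow_iff T (j + 2) r c
    rw [← YoungDiagram.mem_iff_lt_rowLen] at h2
    unfold benderKnuthEntry
    rw [if_neg (by tauto), T.zeros h]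

theorem benderKnuth_apply (r c : ℕ) : benderKnuth T j r c = benderKnuthEntry T j r c := rfl

/-- Rewritten entries stay in {j, j + 1}, and only the threshold j + 1 separates these two values.
-/
theorem lenBelow_benderKnuth_of_ne {v : ℕ} (hv : v ≠ j + 1) :
    lenBelow (benderKnuth T j) v = lenBelow T v := by
  funext r
  refine lenBelow_eq fun c => ?_
  rw [lt_lenBelow_iff, benderKnuth_apply]
  refine and_congr_right fun hc => ?_
  have h1 := lt_lenBelow_iff T j r c
  have h2 := lt_lenBelow_iff T (j + 2) r c
  simp only [hc, true_and] at h1 h2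
  unfold benderKnuthEntry
  split_ifs <;> omega

theorem lenBelow_benderKnuth (r : ℕ) :
    lenBelow (benderKnuth T j) (j + 1) r = toggledLen T j r := by
  refine lenBelow_eq fun c => ?_
  rw [benderKnuth_apply]
  have h1 := lt_lenBelow_iff T j r c
  have h2 := lt_lenBelow_iff T (j + 2) r c
  have h3 := le_toggledLen T j r
  have h4 := toggledLen_le T j r
  have h5 := lenBelow_le_rowLen T (j + 2) r
  unfold benderKnuthEntry
  split_ifs <;> omega

/-- The outer row lengths, hence the intervals, are unchanged, and reflecting twice in the same
interval is the identity. -/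
theorem benderKnuth_involutive : benderKnuth (benderKnuth T j) j = T := by
  have ha := lenBelow_benderKnuth_of_ne T j (v := j) (by omega)
  have hb := lenBelow_benderKnuth_of_ne T j (v := j + 2) (by omega)
  ext r c
  rw [benderKnuth_apply]
  unfold benderKnuthEntry
  rw [ha, hb]
  have hl : toggledLen (benderKnuth T j) j r = lenBelow T (j + 1) r := by
    unfold toggledLen
    rw [ha, hb, lenBelow_benderKnuth]
    have h1 := lowerLen_le T j r
    have h2 := le_upperLen T j r
    unfold toggledLen
    omega
  rw [hl, benderKnuth_apply]
  have h1 := lt_lenBelow_iff T j r c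
  have h2 := lt_lenBelow_iff T (j + 2) r c
  have h3 := lt_lenBelow_iff T (j + 1) r c
  unfold benderKnuthEntry
  split_ifs <;> omega

theorem sum_lenBelow_benderKnuth :
    ∑ r ∈ Finset.range (μ.colLen 0), lenBelow (benderKnuth T j) (j + 1) r +
      ∑ r ∈ Finset.range (μ.colLen 0), lenBelow T (j + 1) r =
    ∑ r ∈ Finset.range (μ.colLen 0), lenBelow T j r +
      ∑ r ∈ Finset.range (μ.colLen 0), lenBelow T (j + 2) r := by
  have h := sum_lowerLen_add_upperLen (lenBelow T j) (lenBelow T (j + 2)) (μ.colLen 0)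
  -- Row `μ.colLen 0` is the first empty row, so the boundary terms of the telescoping sum vanish.
  have h0 : lenBelow T (j + 2) (μ.colLen 0) = 0 := by
    refine Nat.eq_zero_of_not_pos fun hpos => ?_
    rw [lt_lenBelow_iff, ← YoungDiagram.mem_iff_lt_rowLen, YoungDiagram.mem_iff_lt_colLen] at hpos
    exact lt_irrefl _ hpos.1
  have h1 : upperLen (lenBelow T j) (lenBelow T (j + 2)) (μ.colLen 0) = 0 := by
    refine Nat.eq_zero_of_le_zero (le_trans ?_ h0.le)
    cases μ.colLen 0 with
    | zero => exact le_rfl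
    | succ r => exact min_le_left _ _
  rw [h0, h1, add_zero, add_zero] at h
  rw [← Finset.sum_add_distrib, ← Finset.sum_add_distrib, ← h]
  refine Finset.sum_congr rfl fun r _ => ?_
  rw [lenBelow_benderKnuth]
  have h1 := lowerLen_le T j r
  have h2 := le_upperLen T j r
  unfold toggledLen
  omega

/-- Multiplicities are differences of successive totals of row lengths. The new and old middle
totals add up to the sum of the outer totals, so the differences for j and j + 1 change places. -/
theorem tableauExponent_benderKnuth :
    tableauExponent (benderKnuth T j) =
      (tableauExponent T).mapDomain (Equiv.swap j (j + 1)) := by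
  ext v
  rw [Finsupp.mapDomain_equiv_apply, Equiv.symm_swap]
  have hsum := sum_lenBelow_benderKnuth T j
  have e1 := tableauExponent_add_sum T
  have e2 := tableauExponent_add_sum (benderKnuth T j)
  have ha := lenBelow_benderKnuth_of_ne T j (v := j) (by omega)
  have hb := lenBelow_benderKnuth_of_ne T j (v := j + 2) (by omega)
  by_cases h1 : v = j
  · subst h1
    rw [Equiv.swap_apply_left]
    have e1' : _ = ∑ r ∈ _, lenBelow T (v + 2) r := e1 (v + 1)
    have e2' := e2 v
    rw [ha] at e2'
    omega
  by_cases h2 : v = j + 1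
  · subst h2
    rw [Equiv.swap_apply_right]
    have e1' := e1 j
    have e2' := e2 (j + 1)
    rw [hb] at e2'
    omega
  rw [Equiv.swap_apply_of_ne_of_ne h1 h2]
  have e1' := e1 v
  have e2' := e2 v
  rw [lenBelow_benderKnuth_of_ne T j h2, lenBelow_benderKnuth_of_ne T j (by omega)] at e2'
  omega

end Pattern

/-! ### Symmetry of Schur functions and reversal of the variables -/

theorem schur_mapDomain_swap (μ : YoungDiagram) (j : ℕ) (m : ℕ →₀ ℕ) :
    schur μ (m.mapDomain (Equiv.swap j (j + 1))) = schur μ m := by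
  have hinv : ∀ m : ℕ →₀ ℕ,
      (m.mapDomain (Equiv.swap j (j + 1))).mapDomain (Equiv.swap j (j + 1)) = m := by
    intro m
    ext v
    simp [Finsupp.mapDomain_equiv_apply]
  unfold schur
  congr 1
  refine Set.ncard_congr (fun T _ => benderKnuth T j) ?_ ?_ ?_
  · intro T hT
    rw [Set.mem_ofPred_eq] at hT ⊢
    rw [tableauExponent_benderKnuth, hT, hinv]
  · intro T T' _ _ h
    rw [← benderKnuth_involutive T j, h, benderKnuth_involutive]
  · intro T hT
    rw [Set.mem_ofPred_eq] at hT
    refine ⟨benderKnuth T j, ?_, benderKnuth_involutive T j⟩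
    rw [Set.mem_ofPred_eq, tableauExponent_benderKnuth, hT]

/-- The permutations of the variables that fix `s_μ`. -/
def schurSymmetries (μ : YoungDiagram) : Submonoid (Equiv.Perm ℕ) where
  carrier := {σ | ∀ m : ℕ →₀ ℕ, schur μ (m.mapDomain σ) = schur μ m}
  one_mem' := by
    intro m
    rw [Equiv.Perm.coe_one, Finsupp.mapDomain_id]
  mul_mem' := by
    intro σ τ hσ hτ m
    rw [Equiv.Perm.coe_mul, Finsupp.mapDomain_comp, hσ, hτ]

/-- The permutation of `ℕ` that reverses `0, …, N - 1` and fixes the other numbers. -/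
def revBelow (N : ℕ) : Equiv.Perm ℕ :=
  Equiv.Perm.extendDomainHom (Fin.equivSubtype (n := N)) Fin.revPerm

theorem revBelow_apply {N v : ℕ} (h : v < N) : revBelow N v = N - 1 - v := by
  refine (Equiv.Perm.extendDomain_apply_subtype Fin.revPerm Fin.equivSubtype h).trans ?_
  simp [Fin.equivSubtype, Fin.val_rev]
  omega

theorem revBelow_mem (μ : YoungDiagram) (N : ℕ) : revBelow N ∈ schurSymmetries μ := by
  cases N with
  | zero =>
    have : revBelow 0 = 1 := by
      rw [revBelow, Subsingleton.elim (Fin.revPerm (n := 0)) 1, map_one]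
    rw [this]
    exact one_mem _
  | succ N =>
    -- Adjacent transpositions generate the symmetric group, and each of them is handled by a
    -- Bender–Knuth involution.
    have h : (⊤ : Submonoid (Equiv.Perm (Fin (N + 1)))) ≤
        (schurSymmetries μ).comap (Equiv.Perm.extendDomainHom (Fin.equivSubtype (n := N + 1))) := by
      rw [← Equiv.Perm.mclosure_swap_castSucc_succ, Submonoid.closure_le]
      rintro _ ⟨i, rfl⟩
      have he : Equiv.Perm.extendDomainHom (Fin.equivSubtype (n := N + 1))
          (Equiv.swap i.castSucc i.succ) = Equiv.swap (i : ℕ) (i + 1) := by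
        ext v
        by_cases hv : v < N + 1
        · refine (Equiv.Perm.extendDomain_apply_subtype _ Fin.equivSubtype hv).trans ?_
          simp only [Equiv.swap_apply_def, Fin.equivSubtype, Equiv.coe_fn_mk, Equiv.coe_fn_symm_mk,
            Fin.ext_iff, Fin.val_castSucc, Fin.val_succ]
          split_ifs <;> simp
        · refine (Equiv.Perm.extendDomain_apply_not_subtype _ Fin.equivSubtype hv).trans ?_
          rw [Equiv.swap_apply_of_ne_of_ne] <;> omega
      change _ ∈ schurSymmetries μ
      rw [he]
      exact schur_mapDomain_swap μ i
    exact h (Submonoid.mem_top Fin.revPerm)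

/-- Reversal of a word together with reversal of the letters below `N`. -/
def revWord {n : ℕ} (N : ℕ) (i : Fin n → ℕ) : Fin n → ℕ := fun j => revBelow N (i j.rev)

theorem wordExponent_revWord {n : ℕ} (N : ℕ) (i : Fin n → ℕ) :
    wordExponent (revWord N i) = (wordExponent i).mapDomain (revBelow N) := by
  unfold wordExponent revWord
  rw [Finsupp.mapDomain_finsetSum, ← Equiv.sum_comp Fin.revPerm]
  simp only [Fin.revPerm_apply, Fin.rev_rev, Finsupp.mapDomain_single]

theorem isCompatible_revWord {n N : ℕ} {D E : Set ℕ} {i : Fin n → ℕ} (hN : ∀ j, i j < N)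
    (hDE : ∀ d ∈ E, d + 1 < n → n - 2 - d ∈ D) (hi : IsCompatible D i) :
    IsCompatible E (revWord N i) := by
  constructor
  · intro a b hab
    have h := hi.1 (Fin.rev_le_rev.2 hab)
    simp only [revWord]
    rw [revBelow_apply (hN _), revBelow_apply (hN _)]
    omega
  · intro d h hd
    have h1 := hi.2 (n - 2 - d) (by omega) (hDE d hd h)
    have e1 : (Fin.rev ⟨d + 1, h⟩ : Fin n) = ⟨n - 2 - d, by omega⟩ :=
      Fin.ext (by simp only [Fin.val_rev]; omega)
    have e2 : (Fin.rev ⟨d, Nat.lt_of_succ_lt h⟩ : Fin n) = ⟨n - 2 - d + 1, by omega⟩ :=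
      Fin.ext (by simp only [Fin.val_rev]; omega)
    have h2 := hN ⟨n - 2 - d + 1, by omega⟩
    simp only [revWord]
    rw [revBelow_apply (hN _), revBelow_apply (hN _), e1, e2]
    omega

theorem revBelow_revBelow {N v : ℕ} (h : v < N) : revBelow N (revBelow N v) = v := by
  rw [revBelow_apply h, revBelow_apply (by omega)]
  omega

theorem mapDomain_revBelow_support {N : ℕ} {m : ℕ →₀ ℕ} (hm : ∀ v ∈ m.support, v < N) :
    ∀ v ∈ (m.mapDomain (revBelow N)).support, v < N := by
  classical
  intro v hv
  obtain ⟨u, hu, rfl⟩ := Finset.mem_image.1 (Finsupp.mapDomain_support hv)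
  rw [revBelow_apply (hm u hu)]
  have := hm u hu
  omega

/-- Reversing a word together with the order of its letters keeps it weakly increasing and mirrors
the positions of its strict steps. The bound `hm` keeps all letters below N, where `revBelow` is the
reversal. -/
theorem fundamentalQSym_revPos {n N : ℕ} (D : Set ℕ) (m : ℕ →₀ ℕ)
    (hm : ∀ v ∈ m.support, v < N) :
    fundamentalQSym n (revPos n D) m = fundamentalQSym n D (m.mapDomain (revBelow N)) := by
  have hlt : ∀ {m : ℕ →₀ ℕ} {i : Fin n → ℕ}, (∀ v ∈ m.support, v < N) → wordExponent i = m →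
      ∀ j, i j < N := by
    rintro m i hm rfl j
    exact hm _ (Finsupp.mem_support_iff.2 (wordExponent_apply_ne_zero i j))
  have hrev : ∀ {i : Fin n → ℕ}, (∀ j, i j < N) → revWord N (revWord N i) = i := by
    intro i hi
    funext j
    simp only [revWord, Fin.rev_rev]
    exact revBelow_revBelow (hi j)
  unfold fundamentalQSym
  simp only [← and_assoc]
  congr 1
  refine Set.ncard_congr (fun i _ => revWord N i) ?_ ?_ ?_
  · rintro i ⟨hi, rfl⟩
    refine ⟨isCompatible_revWord (D := revPos n D) (hlt hm rfl) ?_ hi, wordExponent_revWord N i⟩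
    intro d hd hdn
    refine ⟨by omega, ?_⟩
    rwa [show n - 2 - (n - 2 - d) = d by omega]
  · rintro i i' ⟨_, hi⟩ ⟨_, hi'⟩ h
    rw [← hrev (hlt hm hi), ← hrev (hlt hm hi')]
    exact congrArg (revWord N) h
  · rintro i ⟨hi, hie⟩
    have hiN := hlt (mapDomain_revBelow_support hm) hie
    refine ⟨revWord N i, ⟨isCompatible_revWord hiN (fun d hd _ => hd.2) hi, ?_⟩, hrev hiN⟩
    rw [wordExponent_revWord, hie, ← Finsupp.mapDomain_comp]
    conv_rhs => rw [← Finsupp.mapDomain_id (v := m)]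
    exact Finsupp.mapDomain_congr fun v hv => revBelow_revBelow (hm v hv)

/-- Schur functions are symmetric, so reversing all descent sets does not change them. -/
theorem schur_eq_sum_revPos {n : ℕ} (μ : Shape n) :
    schur μ.1 = ∑ Q : StdTab μ, fundamentalQSym n (revPos n (tabDescents Q)) := by
  funext m
  -- No single reversal acts on all of the infinitely many variables; each coefficient gets its own
  -- N beyond the support of `m`.
  have hm : ∀ v ∈ m.support, v < m.support.sup id + 1 := fun v hv =>
    Nat.lt_succ_of_le (Finset.le_sup (f := id) hv)
  rw [sum_powerSeries_apply]
  simp only [fundamentalQSym_revPos _ m hm]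
  rw [← sum_powerSeries_apply, ← schur_eq_sum]
  exact (revBelow_mem μ.1 _ m).symm

theorem schur_conj_eq_sum_revPos {n : ℕ} (μ : Shape n) :
    schur μ.conj.1 =
      ∑ Q : StdTab μ, fundamentalQSym n (revPos n (complPos n (tabDescents Q))) := by
  rw [schur_eq_sum_revPos]
  symm
  refine Fintype.sum_bijective StdTab.transpose (StdTab.transpose_bijective μ) _ _ fun Q => ?_
  rw [tabDescents_transpose]

/-- An identity between `Q(B)` and a combination of Schur functions remains valid after a change of
the descent sets that conjugates Schur functions. -/
theorem sum_fundamentalQSym_of_quasiSym_eq {n : ℕ} {B : Set (Equiv.Perm (Fin n))}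
    {c : Shape n → ℂ} (h : quasiSym B = ∑ μ, c μ • schur μ.1) (f : Set ℕ → Set ℕ)
    (hf : ∀ μ : Shape n, schur μ.conj.1 = ∑ Q : StdTab μ, fundamentalQSym n (f (tabDescents Q))) :
    ∑ π ∈ B.toFinite.toFinset, fundamentalQSym n (f (descentSet π)) =
      ∑ μ, c μ • schur μ.conj.1 := by
  obtain ⟨L, hL⟩ := exists_linearMap_fundamentalQSym n fun D => fundamentalQSym n (f D)
  have h1 := congrArg L h
  rw [quasiSym, map_sum, map_sum] at h1
  rw [← Finset.sum_congr rfl fun π _ => hL _ (descentSet_mem_positionSets π), h1]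
  refine Finset.sum_congr rfl fun μ _ => ?_
  rw [map_smul, schur_eq_sum, map_sum, hf]
  congr 1
  exact Finset.sum_congr rfl fun Q _ => hL _ (tabDescents_mem_positionSets Q)

/-! ### Characters of Specht modules -/

section GroupAlgebra

variable {G : Type*}

/-- The standard Hermitian form on the group algebra. -/
noncomputable def hermForm [Fintype G] (x y : MonoidAlgebra ℂ G) : ℂ :=
  ∑ g, (starRingEnd ℂ) (x.coeff g) * y.coeff g

theorem eq_zero_of_hermForm_self [Fintype G] {x : MonoidAlgebra ℂ G} (h : hermForm x x = 0) : x = 0 := by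
  have h1 : ∑ g, Complex.normSq (x.coeff g) = 0 := by
    have : ((∑ g, Complex.normSq (x.coeff g) : ℝ) : ℂ) = hermForm x x := by
      simp only [hermForm, Complex.normSq_eq_conj_mul_self, Complex.ofReal_sum]
    exact_mod_cast this.trans h
  ext g
  have := (Finset.sum_eq_zero_iff_of_nonneg fun g _ => Complex.normSq_nonneg (x.coeff g)).1 h1 g
    (Finset.mem_univ g)
  simpa using this

theorem hermForm_mul_of [Group G] [Fintype G] (x y : MonoidAlgebra ℂ G) (σ : G) :
    hermForm (x * MonoidAlgebra.of ℂ G σ) y = hermForm x (y * MonoidAlgebra.of ℂ G σ⁻¹) := by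
  unfold hermForm
  rw [← Equiv.sum_comp (Equiv.mulRight σ)]
  refine Finset.sum_congr rfl fun g _ => ?_
  simp [MonoidAlgebra.of_apply]

theorem hermForm_sum_left [Fintype G] {ι : Type*} (s : Finset ι) (f : ι → MonoidAlgebra ℂ G)
    (y : MonoidAlgebra ℂ G) : hermForm (∑ i ∈ s, f i) y = ∑ i ∈ s, hermForm (f i) y := by
  unfold hermForm
  rw [Finset.sum_comm]
  refine Finset.sum_congr rfl fun g _ => ?_
  simp [MonoidAlgebra.coeff_sum, Finset.sum_mul]

theorem hermForm_sum_right [Fintype G] {ι : Type*} (s : Finset ι) (f : ι → MonoidAlgebra ℂ G)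
    (y : MonoidAlgebra ℂ G) : hermForm y (∑ i ∈ s, f i) = ∑ i ∈ s, hermForm y (f i) := by
  unfold hermForm
  rw [Finset.sum_comm]
  refine Finset.sum_congr rfl fun g _ => ?_
  simp [MonoidAlgebra.coeff_sum, Finset.mul_sum]

theorem hermForm_smul_left [Fintype G] (c : ℂ) (x y : MonoidAlgebra ℂ G) :
    hermForm (c • x) y = (starRingEnd ℂ) c * hermForm x y := by
  unfold hermForm
  rw [Finset.mul_sum]
  refine Finset.sum_congr rfl fun g _ => ?_
  simp [mul_assoc]

theorem hermForm_smul_right [Fintype G] (c : ℂ) (x y : MonoidAlgebra ℂ G) :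
    hermForm x (c • y) = c * hermForm x y := by
  unfold hermForm
  rw [Finset.mul_sum]
  refine Finset.sum_congr rfl fun g _ => ?_
  simp [mul_left_comm]

/-- An element `u` of the group algebra is self-adjoint if right multiplication by it is. -/
def IsSelfAdj [Group G] [Fintype G] (u : MonoidAlgebra ℂ G) : Prop :=
  ∀ x y, hermForm (x * u) y = hermForm x (y * u)

/-- The adjoint of right multiplication by σ is that by σ⁻¹, and integer weights are fixed by
complex conjugation. -/
theorem isSelfAdj_sum [Group G] [Fintype G] (s : Finset G) (hs : ∀ σ ∈ s, σ⁻¹ ∈ s) (w : G → ℤ)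
    (hw : ∀ σ, w σ⁻¹ = w σ) :
    IsSelfAdj (∑ σ ∈ s, (w σ : ℂ) • MonoidAlgebra.of ℂ G σ) := by
  intro x y
  rw [Finset.mul_sum, Finset.mul_sum, hermForm_sum_left, hermForm_sum_right]
  refine Finset.sum_bij' (fun σ _ => σ⁻¹) (fun σ _ => σ⁻¹) hs hs (fun σ _ => inv_inv σ)
    (fun σ _ => inv_inv σ) fun σ _ => ?_
  rw [mul_smul_comm, mul_smul_comm, hermForm_smul_left, hermForm_smul_right, hermForm_mul_of, hw,
    map_intCast]

/-- For y = xab, moving b and then a across the form gives ⟨y, y⟩ = ⟨x, yba⟩. Thus right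
multiplication by ba is injective on the left ideal generated by ab, which allows the two factors of
a Young symmetrizer to be exchanged. -/
theorem eq_zero_of_mul_mul_eq_zero [Group G] [Fintype G] {a b : MonoidAlgebra ℂ G} (ha : IsSelfAdj a) (hb : IsSelfAdj b)
    {y : MonoidAlgebra ℂ G} (hy : y ∈ Ideal.span {a * b}) (h : y * (b * a) = 0) : y = 0 := by
  obtain ⟨x, rfl⟩ := Ideal.mem_span_singleton'.1 hy
  apply eq_zero_of_hermForm_self
  calc hermForm (x * (a * b)) (x * (a * b)) = hermForm (x * a * b) (x * (a * b)) := by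
        rw [mul_assoc]
    _ = hermForm (x * a) (x * (a * b) * b) := hb _ _
    _ = hermForm x (x * (a * b) * b * a) := ha _ _
    _ = hermForm x (x * (a * b) * (b * a)) := by rw [mul_assoc _ b a]
    _ = 0 := by rw [h]; simp [hermForm]

/-- The action of the group on a left ideal of its group algebra. -/
noncomputable def idealRep [Group G] (I : Ideal (MonoidAlgebra ℂ G)) : Representation ℂ G I :=
  ((Algebra.lsmul ℂ ℂ I : MonoidAlgebra ℂ G →ₐ[ℂ] Module.End ℂ I) :
    MonoidAlgebra ℂ G →* Module.End ℂ I).comp (MonoidAlgebra.of ℂ G)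

theorem idealRep_apply [Group G] (I : Ideal (MonoidAlgebra ℂ G)) (g : G) (x : I) :
    (idealRep I g x : MonoidAlgebra ℂ G) = MonoidAlgebra.of ℂ G g * x := rfl

instance finiteDimensional_monoidAlgebra [Fintype G] : FiniteDimensional ℂ (MonoidAlgebra ℂ G) :=
  Module.Finite.equiv (MonoidAlgebra.coeffLinearEquiv ℂ : MonoidAlgebra ℂ G ≃ₗ[ℂ] (G →₀ ℂ)).symm

instance finiteDimensional_ideal [Group G] [Fintype G] (I : Ideal (MonoidAlgebra ℂ G)) : FiniteDimensional ℂ I :=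
  inferInstanceAs (FiniteDimensional ℂ (I.restrictScalars ℂ))

/-- Injections in both directions force equal dimensions, so `F` is an isomorphism and the traces
can be compared by conjugation. `F'` serves only to compare dimensions and need not respect the
action. -/
theorem character_idealRep_eq [Group G] [Fintype G] {I J : Ideal (MonoidAlgebra ℂ G)} (s : G → ℂ)
    (F F' : MonoidAlgebra ℂ G →ₗ[ℂ] MonoidAlgebra ℂ G)
    (hF : ∀ x ∈ I, F x ∈ J) (hF' : ∀ x ∈ J, F' x ∈ I)
    (hF0 : ∀ x ∈ I, F x = 0 → x = 0) (hF0' : ∀ x ∈ J, F' x = 0 → x = 0)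
    (hs : ∀ g x, F (MonoidAlgebra.of ℂ G g * x) = s g • (MonoidAlgebra.of ℂ G g * F x)) (g : G) :
    (idealRep I).character g = s g * (idealRep J).character g := by
  let f : I →ₗ[ℂ] J := F.restrict (p := I.restrictScalars ℂ) (q := J.restrictScalars ℂ) hF
  let f' : J →ₗ[ℂ] I := F'.restrict (p := J.restrictScalars ℂ) (q := I.restrictScalars ℂ) hF'
  have hf : Function.Injective f := by
    rw [injective_iff_map_eq_zero]
    intro x hx
    exact Subtype.ext (hF0 x x.2 (congrArg Subtype.val hx))
  have hf' : Function.Injective f' := by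
    rw [injective_iff_map_eq_zero]
    intro x hx
    exact Subtype.ext (hF0' x x.2 (congrArg Subtype.val hx))
  let e := f.linearEquivOfInjective hf
    (le_antisymm (LinearMap.finrank_le_finrank_of_injective hf)
      (LinearMap.finrank_le_finrank_of_injective hf'))
  unfold Representation.character
  rw [← LinearMap.trace_conj' _ e, ← smul_eq_mul, ← map_smul]
  congr 1
  refine LinearMap.ext fun y => ?_
  obtain ⟨x, rfl⟩ := e.surjective y
  rw [LinearEquiv.conj_apply_apply, LinearEquiv.symm_apply_apply]
  exact Subtype.ext (hs g x)

end GroupAlgebra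

variable {n : ℕ}

theorem specht_eq_idealRep (μ : Shape n) : specht μ = idealRep (spechtIdeal μ) := rfl

/-- The automorphism `σ ↦ sign(σ) σ` of the group algebra. -/
noncomputable def signTwist (n : ℕ) :
    MonoidAlgebra ℂ (Equiv.Perm (Fin n)) →ₐ[ℂ] MonoidAlgebra ℂ (Equiv.Perm (Fin n)) :=
  MonoidAlgebra.lift ℂ _ _
    { toFun := fun σ => ((Equiv.Perm.sign σ : ℤ) : ℂ) • MonoidAlgebra.of ℂ _ σ
      map_one' := by rw [Equiv.Perm.sign_one, map_one]; simp
      map_mul' := fun σ τ => by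
        rw [Equiv.Perm.sign_mul, map_mul, smul_mul_smul_comm]
        push_cast
        rfl }

theorem signTwist_of (σ : Equiv.Perm (Fin n)) :
    signTwist n (MonoidAlgebra.of ℂ _ σ) =
      ((Equiv.Perm.sign σ : ℤ) : ℂ) • MonoidAlgebra.of ℂ _ σ :=
  MonoidAlgebra.lift_of _ _

theorem sign_mul_sign (σ : Equiv.Perm (Fin n)) :
    ((Equiv.Perm.sign σ : ℤ) : ℂ) * ((Equiv.Perm.sign σ : ℤ) : ℂ) = 1 := by
  rcases Int.units_eq_one_or (Equiv.Perm.sign σ) with h | h <;> simp [h]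

theorem signTwist_signTwist (x : MonoidAlgebra ℂ (Equiv.Perm (Fin n))) :
    signTwist n (signTwist n x) = x := by
  induction x using MonoidAlgebra.induction_on with
  | of σ => rw [signTwist_of, map_smul, signTwist_of, smul_smul, sign_mul_sign, one_smul]
  | add x y hx hy => rw [map_add, map_add, hx, hy]
  | smul r x hx => rw [map_smul, map_smul, hx]

theorem rowSum_isSelfAdj (μ : Shape n) : IsSelfAdj (rowSum μ) := by
  have h := isSelfAdj_sum (Finset.univ.filter fun σ : Equiv.Perm (Fin n) =>
    ∀ i, rowOf μ (σ i) = rowOf μ i) ?_ (fun _ => 1) (fun _ => rfl)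
  · unfold rowSum
    convert h using 3 with σ
    simp
  · intro σ hσ
    simp only [Finset.mem_filter, Finset.mem_univ, true_and] at hσ ⊢
    intro i
    rw [← hσ, ← Equiv.Perm.mul_apply, mul_inv_cancel, Equiv.Perm.one_apply]

theorem colSum_isSelfAdj (μ : Shape n) : IsSelfAdj (colSum μ) := by
  have h := isSelfAdj_sum (Finset.univ.filter fun σ : Equiv.Perm (Fin n) =>
    ∀ i, colOf μ (σ i) = colOf μ i) ?_ (fun σ => (Equiv.Perm.sign σ : ℤ))
    (fun σ => by rw [Equiv.Perm.sign_inv])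
  · unfold colSum
    convert h using 3
  · intro σ hσ
    simp only [Finset.mem_filter, Finset.mem_univ, true_and] at hσ ⊢
    intro i
    rw [← hσ, ← Equiv.Perm.mul_apply, mul_inv_cancel, Equiv.Perm.one_apply]

/-- The permutation that matches the chosen fillings of a partition and of its conjugate. -/
noncomputable def conjPerm (μ : Shape n) : Equiv.Perm (Fin n) :=
  ((filling μ).symm.trans (swapCells μ)).trans (filling μ.conj)

theorem rowOf_conjPerm (μ : Shape n) (i : Fin n) : rowOf μ.conj (conjPerm μ i) = colOf μ i := by
  simp [rowOf, colOf, conjPerm, swapCells]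

theorem colOf_conjPerm (μ : Shape n) (i : Fin n) : colOf μ.conj (conjPerm μ i) = rowOf μ i := by
  simp [rowOf, colOf, conjPerm, swapCells]

theorem preserves_conj_iff {f f' : Fin n → ℕ} {τ : Equiv.Perm (Fin n)}
    (h : ∀ i, f' (τ i) = f i) (σ : Equiv.Perm (Fin n)) :
    (∀ i, f' ((τ * σ * τ⁻¹) i) = f' i) ↔ ∀ i, f (σ i) = f i := by
  rw [← τ.forall_congr_right]
  simp [h]

theorem rowSum_conj (μ : Shape n) :
    rowSum μ.conj = MonoidAlgebra.of ℂ _ (conjPerm μ) * signTwist n (colSum μ) *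
      MonoidAlgebra.of ℂ _ (conjPerm μ)⁻¹ := by
  classical
  unfold rowSum colSum
  rw [map_sum, Finset.mul_sum, Finset.sum_mul]
  symm
  refine Finset.sum_equiv (MulAut.conj (conjPerm μ)).toEquiv ?_ ?_
  · intro σ
    simp only [Finset.mem_filter, Finset.mem_univ, true_and]
    exact (preserves_conj_iff (rowOf_conjPerm μ) σ).symm
  · intro σ _
    rw [map_smul, signTwist_of, smul_smul, sign_mul_sign, one_smul, ← map_mul, ← map_mul]
    rfl

theorem colSum_conj (μ : Shape n) :
    colSum μ.conj = MonoidAlgebra.of ℂ _ (conjPerm μ) * signTwist n (rowSum μ) *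
      MonoidAlgebra.of ℂ _ (conjPerm μ)⁻¹ := by
  classical
  unfold rowSum colSum
  rw [map_sum, Finset.mul_sum, Finset.sum_mul]
  symm
  refine Finset.sum_equiv (MulAut.conj (conjPerm μ)).toEquiv ?_ ?_
  · intro σ
    simp only [Finset.mem_filter, Finset.mem_univ, true_and]
    exact (preserves_conj_iff (colOf_conjPerm μ) σ).symm
  · intro σ _
    rw [signTwist_of, mul_smul_comm, smul_mul_assoc, ← map_mul, ← map_mul]
    have : Equiv.Perm.sign ((MulAut.conj (conjPerm μ)).toEquiv σ) = Equiv.Perm.sign σ := by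
      change Equiv.Perm.sign (conjPerm μ * σ * (conjPerm μ)⁻¹) = _
      rw [map_mul, map_mul, mul_right_comm, ← map_mul, mul_inv_cancel, map_one, one_mul]
    rw [this]
    rfl

theorem of_inv_mul_of (τ : Equiv.Perm (Fin n)) :
    MonoidAlgebra.of ℂ _ τ⁻¹ * MonoidAlgebra.of ℂ _ τ = 1 := by
  rw [← map_mul, inv_mul_cancel, map_one]

theorem of_mul_of_inv (τ : Equiv.Perm (Fin n)) :
    MonoidAlgebra.of ℂ _ τ * MonoidAlgebra.of ℂ _ τ⁻¹ = 1 := by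
  rw [← map_mul, mul_inv_cancel, map_one]

/-- Conjugation exchanges rows and columns, and the sign twist exchanges plain and signed sums; the
factors therefore come out in the opposite order. `conjPerm` corrects for the unrelated choices of
filling. -/
theorem youngSymmetrizer_conj (μ : Shape n) :
    rowSum μ.conj * colSum μ.conj = MonoidAlgebra.of ℂ _ (conjPerm μ) *
      signTwist n (colSum μ * rowSum μ) * MonoidAlgebra.of ℂ _ (conjPerm μ)⁻¹ := by
  rw [rowSum_conj, colSum_conj, map_mul]
  simp only [mul_assoc]
  rw [← mul_assoc (MonoidAlgebra.of ℂ _ (conjPerm μ)⁻¹), of_inv_mul_of, one_mul]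

/-- The character of the Specht module of the conjugate partition is twisted by the sign. -/
theorem character_specht_conj (μ : Shape n) (g : Equiv.Perm (Fin n)) :
    (specht μ).character g = ((Equiv.Perm.sign g : ℤ) : ℂ) * (specht μ.conj).character g := by
  rw [specht_eq_idealRep, specht_eq_idealRep]
  set a := rowSum μ
  set b := colSum μ
  set t := MonoidAlgebra.of ℂ _ (conjPerm μ) with ht
  set t' := MonoidAlgebra.of ℂ _ (conjPerm μ)⁻¹ with ht'
  have htt' : t * t' = 1 := of_mul_of_inv _
  have ht't : t' * t = 1 := of_inv_mul_of _
  have hJ : ∀ y : MonoidAlgebra ℂ (Equiv.Perm (Fin n)), y ∈ spechtIdeal μ.conj ↔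
      signTwist n (y * t) ∈ Ideal.span {b * a} := by
    intro y
    rw [spechtIdeal, youngSymmetrizer_conj, Ideal.mem_span_singleton', Ideal.mem_span_singleton']
    constructor
    · rintro ⟨x, rfl⟩
      refine ⟨signTwist n (x * t), ?_⟩
      change _ = signTwist n (x * (t * signTwist n (b * a) * t') * t)
      rw [mul_assoc x, mul_assoc _ t' t, ht't, mul_one, ← mul_assoc x, map_mul _ (x * t),
        signTwist_signTwist]
    · rintro ⟨x, hx⟩
      refine ⟨signTwist n x * t', ?_⟩
      rw [mul_assoc, mul_assoc, ← mul_assoc t', ht't, one_mul, ← mul_assoc, ← map_mul, hx,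
        signTwist_signTwist, mul_assoc, htt', mul_one]
  -- Right multiplication by ba, respectively ab, moves between the ideals generated by ab and ba.
  -- The sign twist and the translation by t' or t relate the latter to the ideal of the conjugate.
  -- Left multiplication by σ passes through the first map up to the sign introduced by the twist.
  refine character_idealRep_eq (fun σ => ((Equiv.Perm.sign σ : ℤ) : ℂ))
    (LinearMap.mulRight ℂ t' ∘ₗ (signTwist n).toLinearMap ∘ₗ LinearMap.mulRight ℂ (b * a))
    (LinearMap.mulRight ℂ (a * b) ∘ₗ (signTwist n).toLinearMap ∘ₗ LinearMap.mulRight ℂ t)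
    ?_ ?_ ?_ ?_ ?_ g
  · intro x _
    rw [hJ]
    simp only [LinearMap.comp_apply, LinearMap.mulRight_apply, AlgHom.toLinearMap_apply]
    rw [mul_assoc, ht't, mul_one, signTwist_signTwist]
    exact Ideal.mul_mem_left _ _ (Ideal.mem_span_singleton_self _)
  · intro x _
    exact Ideal.mul_mem_left _ _ (Ideal.mem_span_singleton_self _)
  · intro x hx h
    simp only [LinearMap.comp_apply, LinearMap.mulRight_apply, AlgHom.toLinearMap_apply] at h
    refine eq_zero_of_mul_mul_eq_zero (rowSum_isSelfAdj μ) (colSum_isSelfAdj μ) hx ?_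
    rw [← signTwist_signTwist (x * (b * a)), ← mul_one (signTwist n (x * (b * a))), ← ht't,
      ← mul_assoc, h, zero_mul, map_zero]
  · intro x hx h
    simp only [LinearMap.comp_apply, LinearMap.mulRight_apply, AlgHom.toLinearMap_apply] at h
    have h0 := eq_zero_of_mul_mul_eq_zero (colSum_isSelfAdj μ) (rowSum_isSelfAdj μ) ((hJ x).1 hx) h
    have h1 : x * t = 0 := by rw [← signTwist_signTwist (x * t), h0, map_zero]
    rw [← mul_one x, ← htt', ← mul_assoc, h1, zero_mul]
  · intro σ x
    simp only [LinearMap.comp_apply, LinearMap.mulRight_apply, AlgHom.toLinearMap_apply]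
    rw [mul_assoc, map_mul, signTwist_of, smul_mul_assoc, smul_mul_assoc, mul_assoc]

/-! ### The sign representation and tensoring with it -/

theorem rowOf_oneColumn_injective : Function.Injective (rowOf (oneColumn n)) := by
  intro i j h
  have hc : ∀ c : {c // c ∈ (oneColumn n).1.cells}, c.1.2 = 0 := by
    rintro ⟨⟨r, c⟩, hc⟩
    exact Finset.mem_singleton.1 (Finset.mem_product.1 hc).2
  refine (filling (oneColumn n)).symm.injective (Subtype.ext (Prod.ext h ?_))
  rw [hc, hc]

theorem colOf_oneColumn (i : Fin n) : colOf (oneColumn n) i = 0 :=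
  Finset.mem_singleton.1 (Finset.mem_product.1 ((filling (oneColumn n)).symm i).2).2

theorem rowSum_oneColumn : rowSum (oneColumn n) = 1 := by
  classical
  have : (Finset.univ.filter fun σ : Equiv.Perm (Fin n) =>
      ∀ i, rowOf (oneColumn n) (σ i) = rowOf (oneColumn n) i) = {1} := by
    ext σ
    simp only [Finset.mem_filter, Finset.mem_univ, true_and, Finset.mem_singleton]
    refine ⟨fun h => Equiv.ext fun i => rowOf_oneColumn_injective (h i), ?_⟩
    rintro rfl i
    rfl
  unfold rowSum
  rw [Finset.sum_congr (by convert this) fun _ _ => rfl, Finset.sum_singleton, map_one]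

theorem colSum_oneColumn : colSum (oneColumn n) =
    ∑ σ : Equiv.Perm (Fin n), ((Equiv.Perm.sign σ : ℤ) : ℂ) • MonoidAlgebra.of ℂ _ σ := by
  unfold colSum
  rw [Finset.filter_true_of_mem]
  intro σ _ i
  rw [colOf_oneColumn, colOf_oneColumn]

theorem of_mul_colSum_oneColumn (g : Equiv.Perm (Fin n)) :
    MonoidAlgebra.of ℂ _ g * colSum (oneColumn n) =
      ((Equiv.Perm.sign g : ℤ) : ℂ) • colSum (oneColumn n) := by
  rw [colSum_oneColumn, Finset.mul_sum, Finset.smul_sum]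
  refine Fintype.sum_equiv (Equiv.mulLeft g) _ _ fun σ => ?_
  rw [mul_smul_comm, smul_smul, ← map_mul, Equiv.coe_mulLeft, Equiv.Perm.sign_mul, Units.val_mul,
    Int.cast_mul, ← mul_assoc, sign_mul_sign, one_mul]

theorem mul_colSum_oneColumn (x : MonoidAlgebra ℂ (Equiv.Perm (Fin n))) :
    ∃ c : ℂ, x * colSum (oneColumn n) = c • colSum (oneColumn n) := by
  induction x using MonoidAlgebra.induction_on with
  | of g => exact ⟨_, of_mul_colSum_oneColumn g⟩
  | add x y hx hy =>
    obtain ⟨c, hc⟩ := hx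
    obtain ⟨d, hd⟩ := hy
    exact ⟨c + d, by rw [add_mul, hc, hd, add_smul]⟩
  | smul r x hx =>
    obtain ⟨c, hc⟩ := hx
    exact ⟨r * c, by rw [smul_mul_assoc, hc, smul_smul]⟩

theorem colSum_oneColumn_ne_zero : colSum (oneColumn n) ≠ 0 := by
  intro h
  have h1 := congrArg (fun x => x.coeff 1) h
  rw [colSum_oneColumn] at h1
  simp [MonoidAlgebra.coeff_sum, MonoidAlgebra.of_apply, Finsupp.single_apply] at h1

/-- The Specht module of `(1^n)` is the sign representation. -/
theorem character_specht_oneColumn (g : Equiv.Perm (Fin n)) :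
    (specht (oneColumn n)).character g = ((Equiv.Perm.sign g : ℤ) : ℂ) := by
  have hmem : ∀ x : spechtIdeal (oneColumn n), ∃ c : ℂ, c • colSum (oneColumn n) = x.1 := by
    rintro ⟨x, hx⟩
    rw [spechtIdeal, rowSum_oneColumn, one_mul] at hx
    obtain ⟨y, rfl⟩ := Ideal.mem_span_singleton'.1 hx
    obtain ⟨c, hc⟩ := mul_colSum_oneColumn y
    exact ⟨c, hc.symm⟩
  have hε : colSum (oneColumn n) ∈ spechtIdeal (oneColumn n) := by
    rw [spechtIdeal, rowSum_oneColumn, one_mul]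
    exact Ideal.mem_span_singleton_self _
  have hrank : Module.finrank ℂ (spechtIdeal (oneColumn n)) = 1 := by
    refine finrank_eq_one ⟨colSum (oneColumn n), hε⟩ ?_ ?_
    · exact fun h => colSum_oneColumn_ne_zero (congrArg Subtype.val h)
    · intro x
      obtain ⟨c, hc⟩ := hmem x
      exact ⟨c, Subtype.ext hc⟩
  have hact : specht (oneColumn n) g = ((Equiv.Perm.sign g : ℤ) : ℂ) • LinearMap.id := by
    refine LinearMap.ext fun x => Subtype.ext ?_
    obtain ⟨c, hc⟩ := hmem x
    rw [specht_eq_idealRep, idealRep_apply, ← hc, mul_smul_comm, of_mul_colSum_oneColumn,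
      smul_comm, hc]
    rfl
  rw [Representation.character, hact, map_smul, LinearMap.trace_id, hrank]
  simp

/-- The coefficients of the product of a class function with the sign character. -/
theorem multiplicity_sign_mul (χ : Equiv.Perm (Fin n) → ℂ) (μ : Shape n) :
    multiplicity (fun g => ((Equiv.Perm.sign g : ℤ) : ℂ) * χ g) μ = multiplicity χ μ.conj := by
  unfold multiplicity
  congr 1
  refine Finset.sum_congr rfl fun g _ => ?_
  rw [character_specht_conj μ, Equiv.Perm.sign_inv]
  linear_combination (χ g * (specht μ.conj).character g⁻¹) * sign_mul_sign g

/-- Reindexing by conjugation keeps the coefficients of `ρ` itself and moves the conjugation to the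
Schur functions, the form in which the reflected grid classes are computed. -/
theorem frobeniusImage_specht_oneColumn_tprod {V : Type*} [AddCommGroup V] [Module ℂ V]
    [FiniteDimensional ℂ V] (ρ : Representation ℂ (Equiv.Perm (Fin n)) V) :
    frobeniusImage (Representation.character (V := spechtIdeal (oneColumn n) ⊗[ℂ] V)
        ((specht (oneColumn n)).tprod ρ)) =
      ∑ μ : Shape n, multiplicity ρ.character μ • schur μ.conj.1 := by
  have : FiniteDimensional ℂ (spechtIdeal (oneColumn n)) := finiteDimensional_ideal _
  have h : Representation.character (V := spechtIdeal (oneColumn n) ⊗[ℂ] V)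
      ((specht (oneColumn n)).tprod ρ) = fun g => ((Equiv.Perm.sign g : ℤ) : ℂ) * ρ.character g := by
    rw [Representation.char_tensor]
    funext g
    rw [Pi.mul_apply, character_specht_oneColumn]
  rw [h, frobeniusImage]
  refine Fintype.sum_equiv (conjEquiv n) _ _ fun μ => ?_
  rw [multiplicity_sign_mul]
  change _ = multiplicity ρ.character μ.conj • schur μ.conj.conj.1
  rw [Shape.conj_conj]

/-! ### Generating functions of reflected grid classes -/

theorem quasiSym_reflectVer_of_eq {k l n : ℕ} {M : Matrix (Fin k) (Fin l) SignType}
    {c : Shape n → ℂ} (h : quasiSym (gridClass n M) = ∑ μ, c μ • schur μ.1) :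
    quasiSym (gridClass n (reflectVer M)) = ∑ μ, c μ • schur μ.conj.1 := by
  rw [quasiSym_gridClass_reflectVer]
  exact sum_fundamentalQSym_of_quasiSym_eq h _ schur_conj_eq_sum

theorem quasiSym_reflectHor_of_eq {k l n : ℕ} {M : Matrix (Fin k) (Fin l) SignType}
    {c : Shape n → ℂ} (h : quasiSym (gridClass n M) = ∑ μ, c μ • schur μ.1) :
    quasiSym (gridClass n (reflectHor M)) = ∑ μ, c μ • schur μ.conj.1 := by
  rw [quasiSym_gridClass_reflectHor]
  exact sum_fundamentalQSym_of_quasiSym_eq h (fun D => revPos n (complPos n D))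
    schur_conj_eq_sum_revPos

theorem sum_smul_schur_conj {n : ℕ} (c : Shape n → ℂ) :
    ∑ μ : Shape n, c μ • schur μ.conj.1 = ∑ μ : Shape n, c μ.conj • schur μ.1 := by
  refine Fintype.sum_equiv (conjEquiv n) _ _ fun μ => ?_
  change _ = c μ.conj.conj • schur μ.conj.1
  rw [Shape.conj_conj]

end GridReflections

open GridReflections
theorem proposition7p2 {k l : ℕ} (M : Matrix (Fin k) (Fin l) SignType) (n : ℕ) :
    (∀ {V : Type*} [AddCommGroup V] [Module ℂ V] [FiniteDimensional ℂ V]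
        (ρ : Representation ℂ (Equiv.Perm (Fin n)) V),
        IsFineFor (gridClass n M) ρ →
        IsFineFor (V := spechtIdeal (oneColumn n) ⊗[ℂ] V) (gridClass n (reflectVer M))
            ((specht (oneColumn n)).tprod ρ) ∧
        IsFineFor (V := spechtIdeal (oneColumn n) ⊗[ℂ] V) (gridClass n (reflectHor M))
            ((specht (oneColumn n)).tprod ρ)) ∧
    (IsSchurPositive (gridClass n M) →
      quasiSym (gridClass n M) = quasiSym (gridClass n (rotate180 M))) := by
  refine ⟨fun ρ hρ => ⟨?_, ?_⟩, ?_⟩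
  · unfold IsFineFor
    rw [frobeniusImage_specht_oneColumn_tprod]
    -- By the definition of `frobeniusImage`, fineness is itself a Schur expansion, with the
    -- multiplicities in `ρ` as coefficients.
    exact (quasiSym_reflectVer_of_eq hρ.symm).symm
  · unfold IsFineFor
    rw [frobeniusImage_specht_oneColumn_tprod]
    exact (quasiSym_reflectHor_of_eq hρ.symm).symm
  · rintro ⟨c, _, hc⟩
    -- The rotation is the composite of the two reflections. After the first one the sum is
    -- reindexed into an expansion in the s_μ, so that the second reflection applies to it; the two
    -- conjugations then cancel.
    have h := quasiSym_reflectVer_of_eq hc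
    rw [sum_smul_schur_conj] at h
    rw [rotate180_eq, quasiSym_reflectHor_of_eq h, sum_smul_schur_conj, hc]
    simp only [Shape.conj_conj]
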